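/- Let $r\ge 3$ be an odd integer, $q$ a prime power with $q\equiv 1 \pmod{r+1}$, $m\ge 1$, and $k=\mathbb F_{q^m}$. Let $\mathcal M_r$ be the affine curve over $k$ with coordinates $x,y,t$ given by $$y^2=x^3-x^2(t^{r+1}+1)+x\,t^{r+1},\qquad y=x^{\frac{r+1}{2}}+1,$$ and let $F=k(t,x)$ be its function field (the field of fractions of its coordinate ring), so that $$x^{r+1}+2x^{\frac{r+1}{2}}-x^3+x^2(t^{r+1}+1)-x\,t^{r+1}+1=0 .$$ For a place $P$ of $F/k$ let $v_P$ be the normalized discrete valuation, and for $P$ above the place $t=\infty$ of $k(t)$ let $e(P)$ and $f(P)$ be the ramification index and the relative degree over $t=\infty$. 1. Suppose $-1$ is a square in $k$, and let $i\in k$ with $i^2=-1$. Then there are exactly four places $P_1,P_2,P_3,P_4$ of $F$ above $t=\infty$, with $e(P_1)=e(P_2)=1$, $e(P_3)=e(P_4)=\frac{r-1}{2}$ and $f(P_j)=1$ for all $j$. They are labelled so that $t^{r+1}x-1\in P_1$, $x-1\in P_2$, $t^{-\frac{r+1}{2}}x^{\frac{r-1}{2}}-i\in P_3$ and $t^{-\frac{r+1}{2}}x^{\frac{r-1}{2}}+i\in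 P_4$ (that is, $P_1$, $P_2$ and $P_3,P_4$ correspond to the segments of slope $-(r+1)$, $0$ and $\frac{r+1}{r-1}$ of the Newton arc at $t=\infty$ of the above equation of $x$ over $k(t)$). Moreover $$v_{P_1}(x)=r+1,\qquad v_{P_2}(x)=0,\qquad v_{P_3}(x)=v_{P_4}(x)=-\frac{r+1}{2},$$ and the divisor of $x$ in $F$ is $(x)=(r+1)P_1-\frac{r+1}{2}P_3-\frac{r+1}{2}P_4$. 2. Suppose $-1$ is not a square in $k$. Then there are exactly three places $P_1,P_2,P_3$ of $F$ above $t=\infty$, with $e(P_1)=e(P_2)=1$, $f(P_1)=f(P_2)=1$, $e(P_3)=\frac{r-1}{2}$ and $f(P_3)=2$. They are labelled so that $t^{r+1}x-1\in P_1$, $x-1\in P_2$ and $\bigl(t^{-\frac{r+1}{2}}x^{\frac{r-1}{2}}\bigr)^2+1\in P_3$. Moreover $$v_{P_1}(x)=r+1,\qquad v_{P_2}(x)=0,\qquad v_{P_3}(x)=-\frac{r+1}{2},$$ and the divisor of $x$ in $F$ is $(x)=(r+1)P_1-\frac{r+1}{2}P_3$. -/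

import Mathlib

namespace LRCurve

open Polynomial

/-- A place of a field `F` over a field of constants `k`, given by its normalized discrete
valuation: a valuation of `F`, trivial on the nonzero constants, with value group exactly `ℤ`
(written multiplicatively, with `0` adjoined as the value of `0`). -/
@[ext]
structure Place (k F : Type*) [Field k] [Field F] [Algebra k F] where
  /-- the underlying (multiplicative) valuation -/
  val : Valuation F (WithZero (Multiplicative ℤ))
  surjective : Function.Surjective val
  map_const : ∀ c : k, c ≠ 0 → val (algebraMap k F c) = 1

namespace Place

variable {k K L : Type*} [Field k] [Field K] [Field L] [Algebra k K] [Algebra k L]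

/-- The normalized additive valuation `v_P(f)` of a nonzero element `f`
(the value at `f = 0` is irrelevant). -/
def ord (P : Place k L) (f : L) : ℤ := -WithZero.log (P.val f)

/-- `f` belongs to the maximal ideal of the valuation ring of `P`. -/
def Vanishes (P : Place k L) (f : L) : Prop := P.val f < 1

/-- The divisor `D` (a finite integral combination of places) is the principal divisor `(f)`:
`f` is nonzero and the coefficient of `D` at
every place is the valuation of `f` there. -/
def IsDivisorOf (D : Place k L →₀ ℤ) (f : L) : Prop :=
  f ≠ 0 ∧ ∀ P : Place k L, D P = P.ord f

variable [Algebra K L]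

/-- The place `P` of `L` lies over the place `Q` of `K`. -/
def LiesOver (P : Place k L) (Q : Place k K) : Prop := Q.val.HasExtension P.val

/-- `e` is the ramification index of `P` over `Q`. -/
def IsRamificationIndex (P : Place k L) (Q : Place k K) (e : ℕ) : Prop :=
  ∀ f : K, f ≠ 0 → P.ord (algebraMap K L f) = e * Q.ord f

/-- The relative degree of `P` over `Q`: the degree of the extension of residue fields. -/
noncomputable def relativeDegree (P : Place k L) (Q : Place k K) (h : P.LiesOver Q) : ℕ :=
  letI : Q.val.HasExtension P.val := h
  Module.finrank (IsLocalRing.ResidueField Q.val.valuationSubring)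
    (IsLocalRing.ResidueField P.val.valuationSubring)

/-- `P` lies over `Q` with ramification index `e` and relative degree `f`. -/
def LiesOverWith (P : Place k L) (Q : Place k K) (e f : ℕ) : Prop :=
  ∃ h : P.LiesOver Q, P.IsRamificationIndex Q e ∧ P.relativeDegree Q h = f

/-- Given a local parameter `τ` downstairs, a slope `-a / b` of a Newton arc and a lift `ψ` of an
irreducible factor of the residual polynomial of the segment of that slope, the place `P` belongs to
that factor if `ψ (τ ^ (-a) * s ^ b)` lies in `P`. -/
def BelongsTo (P : Place k L) (τ s : L) (a : ℤ) (b : ℕ) (ψ : k[X]) : Prop :=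
  P.Vanishes (aeval (τ ^ (-a) * s ^ b) ψ)

end Place

open Classical in
/-- The place `t = ∞` of the rational function field `k(t)`. -/
noncomputable def placeAtInfinity (k : Type*) [Field k] : Place k (RatFunc k) where
  val := RatFunc.inftyValuation k
  surjective := by
    intro y
    induction y using WithZero.expRecOn with
    | zero => exact ⟨0, map_zero _⟩
    | exp n => exact ⟨RatFunc.X ^ n, RatFunc.inftyValuation.X_zpow k n⟩
  map_const c hc := by
    have := RatFunc.inftyValuation.C k hc
    rwa [← RatFunc.algebraMap_eq_C] at this

section Curve

variable (k : Type*) [Field k] (r : ℕ)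

/-- The ideal of the affine curve
`y² = x³ - x²(t^(r+1) + 1) + x t^(r+1)`, `y = x^((r+1)/2) + 1`
in affine 3-space with coordinates `x = X 0`, `y = X 1`, `t = X 2`. -/
noncomputable def curveIdeal : Ideal (MvPolynomial (Fin 3) k) :=
  let x : MvPolynomial (Fin 3) k := MvPolynomial.X 0
  let y : MvPolynomial (Fin 3) k := MvPolynomial.X 1
  let t : MvPolynomial (Fin 3) k := MvPolynomial.X 2
  Ideal.span {y ^ 2 - (x ^ 3 - x ^ 2 * (t ^ (r + 1) + 1) + x * t ^ (r + 1)),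
    y - (x ^ ((r + 1) / 2) + 1)}

/-- The affine coordinate ring of the curve. Its field of fractions is the function field. -/
abbrev CoordRing : Type _ := MvPolynomial (Fin 3) k ⧸ curveIdeal k r

variable (F : Type*) [Field F] [Algebra (CoordRing k r) F]

/-- The coordinate function `x` in the function field. -/
noncomputable def xFun : F :=
  algebraMap (CoordRing k r) F (Ideal.Quotient.mk (curveIdeal k r) (MvPolynomial.X 0))

/-- The coordinate function `t` in the function field. -/
noncomputable def tFun : F :=
  algebraMap (CoordRing k r) F (Ideal.Quotient.mk (curveIdeal k r) (MvPolynomial.X 2))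

end Curve

end LRCurve

/-!
On a valuation `v` of `F` trivial on `k`, the equation of the curve forces `1 < v t` as soon as
`v x ≠ 1`, so the places above `t = ∞` fall into three families: `v x < 1`, `v x = 1 < v t` and
`1 < v x`. In each family put `u = t⁻¹`, `z = x * t ^ (r + 1)`, respectively `u = t⁻¹`, `z = x`,
respectively `u = t / x`, `z = t ^ (-(r + 1) / 2) * x ^ ((r - 1) / 2)`. Then `u` vanishes, and `z`
reduces to a root of `ψ = X - 1` in the first two cases and of an irreducible factor `ψ` of
`X ^ 2 + 1` in the third. The pair `(u, z)` satisfies an equation whose reduction modulo `u` has `ψ`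
as a simple factor, so `(0, root of ψ)` is a smooth point of a plane model: its local ring is a
discrete valuation ring with uniformizer `u` and residue field generated by `z`. Hence there is
exactly one place centered there, its relative degree is `deg ψ`, and the values of `x` and `t` are
read off from those of `u` and `z`.

Some place lies in each family because `x` is transcendental over `k`. When `-1 = c ^ 2`, both
`z = c` and `z = -c` occur: over `k(x)` the square of `z` is rational, and the conjugation
`z ↦ -z` exchanges the two.
-/

namespace LRCurve

open Polynomial WithZero IsLocalRing

section PlaneModel

variable {k R : Type*} [Field k] [CommRing R] [Algebra k R] {u z : R}

theorem exists_eq_aeval_add_mul (h : Algebra.adjoin k {u, z} = ⊤) (f : R) :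
    ∃ (p : k[X]) (g : R), f = aeval z p + u * g := by
  have hf : f ∈ Algebra.adjoin k {u, z} := h ▸ Algebra.mem_top
  induction hf using Algebra.adjoin_induction with
  | mem a ha =>
    rcases ha with rfl | rfl
    · exact ⟨0, 1, by simp⟩
    · exact ⟨X, 0, by simp⟩
  | algebraMap c => exact ⟨C c, 0, by simp⟩
  | add a b _ _ ha hb =>
    obtain ⟨p, a', ha⟩ := ha
    obtain ⟨q, b', hb⟩ := hb
    exact ⟨p + q, a' + b', by rw [ha, hb, map_add]; ring⟩
  | mul a b _ _ ha hb =>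
    obtain ⟨p, a', ha⟩ := ha
    obtain ⟨q, b', hb⟩ := hb
    exact ⟨p * q, aeval z p * b' + a' * aeval z q + u * a' * b', by rw [ha, hb, map_mul]; ring⟩

theorem isMaximal_span_pair (h : Algebra.adjoin k {u, z} = ⊤) {ψ : k[X]} (hψ : Irreducible ψ)
    (hne : Ideal.span {u, aeval z ψ} ≠ ⊤) : (Ideal.span {u, aeval z ψ}).IsMaximal := by
  have hu : u ∈ Ideal.span {u, aeval z ψ} := Ideal.subset_span (by simp)
  have hv : aeval z ψ ∈ Ideal.span {u, aeval z ψ} := Ideal.subset_span (by simp)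
  refine Ideal.isMaximal_iff.2 ⟨(Ideal.ne_top_iff_one _).1 hne, fun J f hJ hf hfJ => ?_⟩
  obtain ⟨p, g, rfl⟩ := exists_eq_aeval_add_mul h f
  have hp : aeval z p ∈ J := (J.add_mem_iff_left (J.mul_mem_right _ (hJ hu))).1 hfJ
  have hψp : ¬ψ ∣ p := by
    rintro ⟨q, rfl⟩
    refine hf (add_mem ?_ (Ideal.mul_mem_right _ _ hu))
    rw [map_mul]
    exact Ideal.mul_mem_right _ _ hv
  obtain ⟨a, b, hab⟩ := hψ.coprime_iff_not_dvd.2 hψp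
  rw [← map_one (aeval (R := k) z), ← hab, map_add, map_mul, map_mul]
  exact add_mem (J.mul_mem_left _ (hJ hv)) (J.mul_mem_left _ hp)

end PlaneModel

section Localization

variable {R : Type*} [CommRing R] {u v s h : R} (m : Ideal R)
  {A : Type*} [CommRing A] [IsLocalRing A] [Algebra R A]

theorem maximalIdeal_eq_span_singleton [m.IsPrime] [IsLocalization.AtPrime A m]
    (hm : m = Ideal.span {u, v}) (hs : s ∉ m) (hsv : s * v = u * h) :
    maximalIdeal A = Ideal.span {algebraMap R A u} := by
  have hs' : IsUnit (algebraMap R A s) := (IsLocalization.AtPrime.isUnit_to_map_iff A m s).2 hs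
  have hv : algebraMap R A u ∣ algebraMap R A v := by
    rw [← hs'.dvd_mul_left, ← map_mul, hsv, map_mul]
    exact dvd_mul_right _ _
  rw [← IsLocalization.AtPrime.map_eq_maximalIdeal m A, congrArg (Ideal.map _) hm, Ideal.map_span,
    Set.image_pair, Ideal.span_insert, sup_eq_left]
  exact Ideal.span_singleton_le_span_singleton.2 hv

theorem exists_sub_algebraMap_mem_maximalIdeal [m.IsMaximal] [IsLocalization.AtPrime A m] (a : A) :
    ∃ f : R, a - algebraMap R A f ∈ maximalIdeal A := by
  obtain ⟨f, hf⟩ := Ideal.Quotient.mk_surjective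
    ((IsLocalization.AtPrime.equivQuotMaximalIdeal m A).symm (Ideal.Quotient.mk _ a))
  refine ⟨f, Ideal.Quotient.eq.1 ?_⟩
  rw [← IsLocalization.AtPrime.equivQuotMaximalIdeal_apply_mk m A, hf, RingEquiv.apply_symm_apply]

end Localization

theorem isDiscreteValuationRing_of_maximalIdeal_eq_span {A : Type*} [CommRing A] [IsDomain A]
    [IsLocalRing A] [IsNoetherianRing A] {ϖ : A} (h0 : ϖ ≠ 0)
    (h : maximalIdeal A = Ideal.span {ϖ}) : IsDiscreteValuationRing A := by
  have hA : ¬IsField A := by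
    rwa [isField_iff_maximalIdeal_eq, h, Ideal.span_singleton_eq_bot]
  have hp : (maximalIdeal A).IsPrincipal := ⟨⟨ϖ, h⟩⟩
  exact ((IsDiscreteValuationRing.TFAE A hA).out 0 4).2 hp

namespace Place

variable {k F : Type*} [Field k] [Field F] [Algebra k F]

theorem val_algebraMap_le_one (P : Place k F) (c : k) : P.val (algebraMap k F c) ≤ 1 := by
  rcases eq_or_ne c 0 with rfl | hc
  · simp
  · exact (P.map_const c hc).le

theorem val_le_exp_neg_one_iff (P : Place k F) {f : F} : P.val f ≤ exp (-1) ↔ P.val f < 1 := by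
  rw [← lt_mul_exp_iff_le exp_ne_zero, ← exp_add, neg_add_cancel, exp_zero]

theorem eq_of_isEquiv {P Q : Place k F} (h : P.val.IsEquiv Q.val) : P = Q := by
  obtain ⟨ϖ, hP⟩ := P.surjective (exp (-1))
  have hQ : Q.val ϖ = exp (-1) := by
    obtain ⟨π, hπ⟩ := Q.surjective (exp (-1))
    refine le_antisymm ?_ ?_
    · rw [val_le_exp_neg_one_iff, ← h.lt_one_iff_lt_one, ← val_le_exp_neg_one_iff, hP]
    · rw [← hπ, ← h, hP, val_le_exp_neg_one_iff, h.lt_one_iff_lt_one, ← val_le_exp_neg_one_iff, hπ]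
  refine Place.ext (Valuation.ext fun f => ?_)
  rcases eq_or_ne f 0 with rfl | hf
  · simp
  set n := -log (P.val f)
  have hPf : P.val f = P.val (ϖ ^ n) := by
    rw [map_zpow₀, hP, ← exp_zsmul, smul_eq_mul, mul_neg_one, neg_neg,
      exp_log (P.val.ne_zero_iff.2 hf)]
  rw [hPf, h.eq_iff.1 hPf, map_zpow₀, map_zpow₀, hP, hQ]

section OfDVR

variable (k F) (A : Type*) [CommRing A] [IsDomain A] [IsDiscreteValuationRing A] [Algebra A F]
  [IsFractionRing A F] [Algebra k A] [IsScalarTower k A F]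

/-- The place of the field of fractions of a discrete valuation ring containing the constants. -/
noncomputable def ofDVR : Place k F where
  val := (IsDiscreteValuationRing.maximalIdeal A).valuation F
  surjective := (IsDiscreteValuationRing.maximalIdeal A).valuation_surjective F
  map_const c hc := by
    rw [IsScalarTower.algebraMap_apply k A F,
      IsDedekindDomain.HeightOneSpectrum.valuation_of_algebraMap,
      IsDedekindDomain.HeightOneSpectrum.intValuation_eq_one_iff]
    exact fun h => (mem_maximalIdeal _).1 h ((IsUnit.mk0 c hc).map (algebraMap k A))

variable {F A}

theorem ofDVR_val_le_one (a : A) : (ofDVR k F A).val (algebraMap A F a) ≤ 1 :=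
  (IsDiscreteValuationRing.maximalIdeal A).valuation_le_one a

theorem ofDVR_val_lt_one_iff {a : A} :
    (ofDVR k F A).val (algebraMap A F a) < 1 ↔ a ∈ maximalIdeal A :=
  (IsDiscreteValuationRing.maximalIdeal A).valuation_lt_one_iff_mem a

theorem ofDVR_val_eq_exp_neg_one {ϖ : A} (h0 : ϖ ≠ 0) (h : maximalIdeal A = Ideal.span {ϖ}) :
    (ofDVR k F A).val (algebraMap A F ϖ) = exp (-1) :=
  ((IsDiscreteValuationRing.maximalIdeal A).valuation_of_algebraMap ϖ).trans
    ((IsDiscreteValuationRing.maximalIdeal A).intValuation_singleton h0 h)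

variable {k}

theorem exists_algebraMap_eq_of_ofDVR_val_le_one {f : F} (hf : (ofDVR k F A).val f ≤ 1) :
    ∃ a : A, algebraMap A F a = f :=
  IsDiscreteValuationRing.exists_lift_of_le_one hf

theorem eq_ofDVR {P : Place k F} (hle : ∀ a : A, P.val (algebraMap A F a) ≤ 1)
    (hlt : ∀ a ∈ maximalIdeal A, P.val (algebraMap A F a) < 1) : P = ofDVR k F A := by
  refine eq_of_isEquiv (Valuation.isEquiv_of_val_le_one fun f => ⟨fun hf => ?_, fun hf => ?_⟩)
  · by_contra! hf'
    have hf0 : f ≠ 0 := by rintro rfl; simp at hf'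
    rw [Valuation.one_lt_val_iff _ hf0] at hf'
    obtain ⟨a, ha⟩ := exists_algebraMap_eq_of_ofDVR_val_le_one hf'.le
    rw [← ha, ofDVR_val_lt_one_iff] at hf'
    refine absurd hf (not_le.2 ((P.val.one_lt_val_iff hf0).2 ?_))
    exact ha ▸ hlt a hf'
  · obtain ⟨a, rfl⟩ := exists_algebraMap_eq_of_ofDVR_val_le_one hf
    exact hle a

end OfDVR

end Place

/-- The center of the valuation `w` on the affine model of `F` with coordinate ring `k[u, z]` is
the closed point `u = 0`, `ψ(z) = 0`. -/
structure IsCenteredAt {k F Γ : Type*} [Field k] [Field F] [Algebra k F]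
    [LinearOrderedCommGroupWithZero Γ] (w : Valuation F Γ) (u z : F) (ψ : k[X]) : Prop where
  const_le_one : ∀ c : k, w (algebraMap k F c) ≤ 1
  left_lt_one : w u < 1
  right_le_one : w z ≤ 1
  aeval_lt_one : w (aeval z ψ) < 1

/-- The residue field of `P` is generated over the constants by the residue class of `z`, whose
minimal polynomial is (up to a constant) `ψ`. -/
structure Place.IsResidueGenerator {k F : Type*} [Field k] [Field F] [Algebra k F]
    (P : Place k F) (z : F) (ψ : k[X]) : Prop where
  irreducible : Irreducible ψ
  val_le_one : P.val z ≤ 1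
  vanishes : P.Vanishes (aeval z ψ)
  exists_vanishes_sub : ∀ f, P.val f ≤ 1 → ∃ p : k[X], P.Vanishes (f - aeval z p)

theorem val_aeval_le_one {k F Γ : Type*} [Field k] [Field F] [Algebra k F]
    [LinearOrderedCommGroupWithZero Γ] {w : Valuation F Γ}
    (hk : ∀ c : k, w (algebraMap k F c) ≤ 1) {z : F} (hz : w z ≤ 1) (p : k[X]) :
    w (aeval z p) ≤ 1 := by
  rw [aeval_eq_sum_range]
  refine w.map_sum_le fun i _ => ?_
  rw [Algebra.smul_def, map_mul, map_pow]
  exact mul_le_one' (hk _) (pow_le_one' hz i)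

section CoordinateRing

variable {k R F Γ : Type*} [Field k] [CommRing R] [Field F] [Algebra k R] [Algebra R F]
  [Algebra k F] [IsScalarTower k R F] [LinearOrderedCommGroupWithZero Γ] {w : Valuation F Γ}

theorem val_algebraMap_le_one_of_adjoin_eq_top {s : Set R} (hs : Algebra.adjoin k s = ⊤)
    (hk : ∀ c : k, w (algebraMap k F c) ≤ 1) (hws : ∀ a ∈ s, w (algebraMap R F a) ≤ 1) (f : R) :
    w (algebraMap R F f) ≤ 1 := by
  have hf : f ∈ Algebra.adjoin k s := hs ▸ Algebra.mem_top
  induction hf using Algebra.adjoin_induction with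
  | mem a ha => exact hws a ha
  | algebraMap c => rw [← IsScalarTower.algebraMap_apply]; exact hk c
  | add a b _ _ ha hb => rw [map_add]; exact w.map_add_le ha hb
  | mul a b _ _ ha hb => rw [map_mul, map_mul]; exact mul_le_one' ha hb

theorem val_algebraMap_lt_one_of_mem_span (hle : ∀ f : R, w (algebraMap R F f) ≤ 1) {s : Set R}
    (hlt : ∀ f ∈ s, w (algebraMap R F f) < 1) {f : R} (hf : f ∈ Ideal.span s) :
    w (algebraMap R F f) < 1 := by
  induction hf using Submodule.span_induction with
  | mem a ha => exact hlt a ha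
  | zero => simp
  | add a b _ _ ha hb => rw [map_add]; exact w.map_add_lt ha hb
  | smul a b _ hb =>
    rw [smul_eq_mul, map_mul, map_mul]
    exact mul_lt_one_of_nonneg_of_lt_one_right (hle a) zero_le hb

theorem val_algebraMap_eq_one_of_notMem_span (hle : ∀ f : R, w (algebraMap R F f) ≤ 1) {s : Set R}
    (hlt : ∀ f ∈ s, w (algebraMap R F f) < 1) (hs : (Ideal.span s).IsMaximal) {f : R}
    (hf : f ∉ Ideal.span s) : w (algebraMap R F f) = 1 := by
  refine (hle f).eq_of_not_lt fun hf1 => ?_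
  obtain ⟨a, b, hb, hab⟩ := hs.exists_inv hf
  have h := val_algebraMap_lt_one_of_mem_span hle
    (Set.forall_mem_insert.2 ⟨hf1, hlt⟩) (f := 1) (by
      rw [← hab]
      exact add_mem (Ideal.mul_mem_left _ _ (Ideal.subset_span (by simp)))
        (Ideal.span_mono (Set.subset_insert _ _) hb))
  rw [map_one, map_one] at h
  exact h.false

theorem val_algebraMap_le_one_of_atPrime (m : Ideal R) [m.IsPrime] {A : Type*} [CommRing A]
    [Algebra R A] [Algebra A F] [IsScalarTower R A F] [IsLocalization.AtPrime A m]
    (hle : ∀ f : R, w (algebraMap R F f) ≤ 1)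
    (hm : ∀ f ∉ m, w (algebraMap R F f) = 1) (a : A) : w (algebraMap A F a) ≤ 1 := by
  obtain ⟨⟨f, s⟩, hfs⟩ := IsLocalization.surj m.primeCompl a
  have := congrArg (fun b => w (algebraMap A F b)) hfs
  simp only [map_mul, ← IsScalarTower.algebraMap_apply, hm s s.2, mul_one] at this
  exact this ▸ hle f

end CoordinateRing

section SmoothPoint

variable {k R F : Type*} [Field k] [CommRing R] [Field F] [Algebra k R] [Algebra R F]
  [Algebra k F] [IsScalarTower k R F] {u z : R} {ψ : k[X]}

namespace IsCenteredAt

variable {Γ : Type*} [LinearOrderedCommGroupWithZero Γ] {w : Valuation F Γ}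
  (hw : IsCenteredAt w (algebraMap R F u) (algebraMap R F z) ψ)
include hw

theorem val_le_one (hR : Algebra.adjoin k {u, z} = ⊤) (f : R) : w (algebraMap R F f) ≤ 1 := by
  refine val_algebraMap_le_one_of_adjoin_eq_top hR hw.const_le_one ?_ f
  rintro a (rfl | rfl)
  exacts [hw.left_lt_one.le, hw.right_le_one]

theorem val_lt_one : ∀ f ∈ ({u, aeval z ψ} : Set R), w (algebraMap R F f) < 1 := by
  rintro a (rfl | rfl)
  · exact hw.left_lt_one
  · rw [← aeval_algebraMap_apply]
    exact hw.aeval_lt_one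

theorem isMaximal (hR : Algebra.adjoin k {u, z} = ⊤) (hψ : Irreducible ψ) :
    (Ideal.span {u, aeval z ψ}).IsMaximal := by
  refine isMaximal_span_pair hR hψ fun h => ?_
  have h1 := val_algebraMap_lt_one_of_mem_span (hw.val_le_one hR) hw.val_lt_one
    ((Ideal.eq_top_iff_one _).1 h)
  rw [map_one, map_one] at h1
  exact h1.false

end IsCenteredAt

namespace Place

section LocalRing

variable (m : Ideal R) [m.IsMaximal] (A : Type*) [CommRing A] [IsDomain A]
  [IsDiscreteValuationRing A] [Algebra R A] [IsLocalization.AtPrime A m] [Algebra A F]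
  [IsFractionRing A F] [IsScalarTower R A F] [Algebra k A] [IsScalarTower k A F]
  (hR : Algebra.adjoin k {u, z} = ⊤) (hm : m = Ideal.span {u, aeval z ψ})
include hR hm

theorem eq_ofDVR_of_isCenteredAt (hA : maximalIdeal A = Ideal.span {algebraMap R A u})
    {P : Place k F} (hP : IsCenteredAt P.val (algebraMap R F u) (algebraMap R F z) ψ) :
    P = ofDVR k F A := by
  have hle := val_algebraMap_le_one_of_atPrime (F := F) (A := A) m (hP.val_le_one hR) fun f hf =>
    val_algebraMap_eq_one_of_notMem_span (hP.val_le_one hR) hP.val_lt_one (hm ▸ ‹m.IsMaximal›)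
      (hm ▸ hf)
  refine eq_ofDVR hle fun a ha => ?_
  obtain ⟨b, rfl⟩ := Ideal.mem_span_singleton.1 (hA ▸ ha)
  rw [map_mul, map_mul, ← IsScalarTower.algebraMap_apply]
  exact mul_lt_one_of_lt_of_le hP.left_lt_one (hle b)

omit [IsScalarTower k R F] in
theorem isResidueGenerator_ofDVR [IsScalarTower k R A] (hψ : Irreducible ψ) :
    (ofDVR k F A).IsResidueGenerator (algebraMap R F z) ψ := by
  have hmem {f : R} (hf : f ∈ m) : algebraMap R A f ∈ maximalIdeal A :=
    (IsLocalization.AtPrime.to_map_mem_maximal_iff A m f).2 hf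
  rw [IsScalarTower.algebraMap_apply R A F]
  refine ⟨hψ, ofDVR_val_le_one k _, ?_, fun f hf => ?_⟩
  · rw [Vanishes, aeval_algebraMap_apply, aeval_algebraMap_apply, ofDVR_val_lt_one_iff]
    exact hmem (hm ▸ Ideal.subset_span (by simp))
  · obtain ⟨a, rfl⟩ := exists_algebraMap_eq_of_ofDVR_val_le_one hf
    obtain ⟨f, hf⟩ := exists_sub_algebraMap_mem_maximalIdeal m a
    obtain ⟨p, g, rfl⟩ := exists_eq_aeval_add_mul hR f
    refine ⟨p, ?_⟩
    rw [Vanishes, aeval_algebraMap_apply, ← map_sub, ofDVR_val_lt_one_iff, aeval_algebraMap_apply]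
    have hu : algebraMap R A (u * g) ∈ maximalIdeal A :=
      hmem (hm ▸ Ideal.mul_mem_right _ _ (Ideal.subset_span (by simp)))
    convert add_mem hf hu using 1
    rw [map_add]
    ring

end LocalRing

theorem exists_of_adjoin_eq_top [IsDomain R] [IsFractionRing R F]
    (hR : Algebra.adjoin k {u, z} = ⊤) (hu : u ≠ 0) (hψ : Irreducible ψ)
    {Γ : Type*} [LinearOrderedCommGroupWithZero Γ] {w : Valuation F Γ}
    (hw : IsCenteredAt w (algebraMap R F u) (algebraMap R F z) ψ) {g h : R}
    (hg : w (algebraMap R F g) = 1) (hgh : g * aeval z ψ = u * h) :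
    ∃ P : Place k F, P.val (algebraMap R F u) = exp (-1) ∧
      P.IsResidueGenerator (algebraMap R F z) ψ ∧
      ∀ P' : Place k F, IsCenteredAt P'.val (algebraMap R F u) (algebraMap R F z) ψ → P' = P := by
  have : Algebra.FiniteType k R := ⟨({u, z} : Set R).toFinite.toFinset, by simpa using hR⟩
  have : IsNoetherianRing R := Algebra.FiniteType.isNoetherianRing k R
  obtain ⟨m, hm⟩ : ∃ m, m = Ideal.span {u, aeval z ψ} := ⟨_, rfl⟩
  have hmax : m.IsMaximal := hm ▸ hw.isMaximal hR hψ
  have hgm : g ∉ m := fun h => hg.not_lt <|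
    val_algebraMap_lt_one_of_mem_span (hw.val_le_one hR) hw.val_lt_one (hm ▸ h)
  let A := Localization.AtPrime m
  let : Algebra A F := IsLocalization.localizationAlgebraOfSubmonoidLe A F m.primeCompl
    (nonZeroDivisors R) m.primeCompl_le_nonZeroDivisors
  have : IsScalarTower R A F := IsLocalization.localization_isScalarTower_of_submonoid_le A F
    m.primeCompl (nonZeroDivisors R) m.primeCompl_le_nonZeroDivisors
  have : IsFractionRing A F :=
    IsFractionRing.isFractionRing_of_isDomain_of_isLocalization m.primeCompl A F
  have : IsScalarTower k A F := .to₁₃₄ k R A F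
  have : IsNoetherianRing A := IsLocalization.isNoetherianRing m.primeCompl A ‹_›
  have hA : maximalIdeal A = Ideal.span {algebraMap R A u} :=
    maximalIdeal_eq_span_singleton m hm hgm hgh
  have hu0 : algebraMap R A u ≠ 0 := (FaithfulSMul.algebraMap_eq_zero_iff R A).not.2 hu
  have : IsDiscreteValuationRing A := isDiscreteValuationRing_of_maximalIdeal_eq_span hu0 hA
  refine ⟨ofDVR k F A, ?_, isResidueGenerator_ofDVR m A hR hm hψ,
    fun P' hP' => eq_ofDVR_of_isCenteredAt m A hR hm hA hP'⟩
  rw [IsScalarTower.algebraMap_apply R A F, ofDVR_val_eq_exp_neg_one k hu0 hA]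

end Place

end SmoothPoint

/-- Since `g` is a unit at the center of `w`, the relation `hgh` makes `u` a generator of the
maximal ideal of the local ring there. -/
theorem Place.exists_of_isCenteredAt {k F Γ : Type*} [Field k] [Field F] [Algebra k F]
    [LinearOrderedCommGroupWithZero Γ] {w : Valuation F Γ} {u z : F} {ψ : k[X]}
    (hF : IntermediateField.adjoin k {u, z} = ⊤) (hu : u ≠ 0) (hψ : Irreducible ψ)
    (hw : IsCenteredAt w u z ψ) {g h : F} (hg : g ∈ Algebra.adjoin k {u, z})
    (hh : h ∈ Algebra.adjoin k {u, z}) (hwg : w g = 1) (hgh : g * aeval z ψ = u * h) :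
    ∃ P : Place k F, P.val u = exp (-1) ∧ P.IsResidueGenerator z ψ ∧
      ∀ P' : Place k F, IsCenteredAt P'.val u z ψ → P' = P := by
  let R := Algebra.adjoin k {u, z}
  have : IsFractionRing R F := by
    refine .of_field _ _ fun f => ?_
    have hf : f ∈ IntermediateField.adjoin k {u, z} := hF ▸ IntermediateField.mem_top
    obtain ⟨a, ha, b, hb, hab⟩ := IntermediateField.mem_adjoin_iff_div.1 hf
    exact ⟨⟨a, ha⟩, ⟨b, hb⟩, hab⟩
  let u' : R := ⟨u, Algebra.subset_adjoin (by simp)⟩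
  let z' : R := ⟨z, Algebra.subset_adjoin (by simp)⟩
  have hR : Algebra.adjoin k {u', z'} = ⊤ := by
    convert Algebra.adjoin_adjoin_coe_preimage (R := k) (s := ({u, z} : Set F))
    ext a
    simp [u', z', Subtype.ext_iff]
  have hgh' : (⟨g, hg⟩ : R) * aeval z' ψ = u' * ⟨h, hh⟩ := by
    refine Subtype.ext ((congrArg (g * ·) ?_).trans hgh)
    exact (aeval_algebraMap_apply F z' ψ).symm
  exact exists_of_adjoin_eq_top (F := F) hR (fun h => hu (congrArg Subtype.val h)) hψ hw hwg hgh'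

namespace Place

section ResidueField

variable {k F : Type*} [Field k] [Field F] [Algebra k F] (P : Place k F)

/-- The residue field of `P` is the field of constants. -/
def IsRational : Prop := ∀ f, P.val f ≤ 1 → ∃ c : k, P.Vanishes (f - algebraMap k F c)

/-- The inclusion of the constants into the valuation ring of `P`. -/
def constHom : k →+* P.val.valuationSubring :=
  (algebraMap k F).codRestrict P.val.valuationSubring.toSubring P.val_algebraMap_le_one

/-- The inclusion of the constants into the residue field of `P`. -/
noncomputable def residueConstHom : k →+* ResidueField P.val.valuationSubring :=
  (residue P.val.valuationSubring).comp P.constHom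

theorem residue_eq_zero_iff_vanishes (a : P.val.valuationSubring) :
    residue P.val.valuationSubring a = 0 ↔ P.Vanishes (a : F) := by
  have hunit : IsUnit a ↔ P.val (a : F) = 1 :=
    (Valuation.integer.integers P.val).isUnit_iff_valuation_eq_one
  rw [residue_eq_zero_iff, mem_maximalIdeal, mem_nonunits_iff, hunit]
  exact (lt_iff_le_and_ne.trans (and_iff_right a.2)).symm

theorem residue_eq_residue_iff_vanishes_sub (a b : P.val.valuationSubring) :
    residue P.val.valuationSubring a = residue P.val.valuationSubring b ↔
      P.Vanishes ((a : F) - b) := by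
  rw [← sub_eq_zero, ← map_sub, residue_eq_zero_iff_vanishes]
  rfl

theorem coe_eval₂_constHom (z : P.val.valuationSubring) (p : k[X]) :
    ((eval₂ P.constHom z p : P.val.valuationSubring) : F) = aeval (z : F) p :=
  hom_eval₂ p P.constHom P.val.valuationSubring.subtype z

theorem eval₂_residueConstHom (z : P.val.valuationSubring) (p : k[X]) :
    eval₂ P.residueConstHom (residue _ z) p =
      residue P.val.valuationSubring (eval₂ P.constHom z p) :=
  (hom_eval₂ p P.constHom (residue _) z).symm

variable {P}

theorem IsRational.residueConstHom_surjective (h : P.IsRational) :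
    Function.Surjective P.residueConstHom := by
  intro y
  obtain ⟨a, rfl⟩ := residue_surjective y
  obtain ⟨c, hc⟩ := h a a.2
  exact ⟨c, ((P.residue_eq_residue_iff_vanishes_sub a (P.constHom c)).2 hc).symm⟩

theorem IsResidueGenerator.exists_adjoinRoot_equiv {z : F} {ψ : k[X]}
    (h : P.IsResidueGenerator z ψ) :
    ∃ j : AdjoinRoot ψ ≃+* ResidueField P.val.valuationSubring,
      ∀ c : k, j (AdjoinRoot.of ψ c) = P.residueConstHom c := by
  have : Fact (Irreducible ψ) := ⟨h.irreducible⟩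
  let z' : P.val.valuationSubring := ⟨z, h.val_le_one⟩
  have hroot : eval₂ P.residueConstHom (residue _ z') ψ = 0 := by
    rw [eval₂_residueConstHom, residue_eq_zero_iff_vanishes, coe_eval₂_constHom]
    exact h.vanishes
  let φ := AdjoinRoot.lift P.residueConstHom (residue _ z') hroot
  refine ⟨RingEquiv.ofBijective φ ⟨φ.injective, fun y => ?_⟩, fun c => AdjoinRoot.lift_of hroot⟩
  obtain ⟨a, rfl⟩ := residue_surjective y
  obtain ⟨p, hp⟩ := h.exists_vanishes_sub a a.2
  refine ⟨AdjoinRoot.mk ψ p, ?_⟩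
  rw [AdjoinRoot.lift_mk, eval₂_residueConstHom, eq_comm, residue_eq_residue_iff_vanishes_sub,
    coe_eval₂_constHom]
  exact hp

theorem IsResidueGenerator.relativeDegree_eq_natDegree {z : F} {ψ : k[X]}
    (h : P.IsResidueGenerator z ψ) {K : Type*} [Field K] [Algebra k K] [Algebra K F]
    [IsScalarTower k K F] {Q : Place k K} (hQ : Q.IsRational) (hPQ : P.LiesOver Q) :
    P.relativeDegree Q hPQ = ψ.natDegree := by
  obtain ⟨j, hj⟩ := h.exists_adjoinRoot_equiv
  let i := RingEquiv.ofBijective Q.residueConstHom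
    ⟨Q.residueConstHom.injective, hQ.residueConstHom_surjective⟩
  have : Q.val.HasExtension P.val := hPQ
  have hcomm : (algebraMap (ResidueField Q.val.valuationSubring)
      (ResidueField P.val.valuationSubring)).comp i =
      (j : AdjoinRoot ψ →+* _).comp (algebraMap k (AdjoinRoot ψ)) := by
    refine RingHom.ext fun c => Eq.trans ?_ (hj c).symm
    refine (Valuation.HasExtension.algebraMap_residue_eq_residue_algebraMap Q.val P.val
      (Q.constHom c)).trans (congrArg (residue _) (Subtype.ext ?_))
    exact (IsScalarTower.algebraMap_apply k K F c).symm
  calc P.relativeDegree Q hPQ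
    _ = Module.finrank k (AdjoinRoot ψ) := (Algebra.finrank_eq_of_equiv_equiv i j hcomm).symm
    _ = ψ.natDegree := by
      rw [(AdjoinRoot.powerBasis h.irreducible.ne_zero).finrank, AdjoinRoot.powerBasis_dim]

end ResidueField

end Place

section Infinity

variable {k : Type*} [Field k]

open Classical in
theorem placeAtInfinity_val {f : RatFunc k} (hf : f ≠ 0) :
    (placeAtInfinity k).val f = exp f.intDegree :=
  RatFunc.inftyValuation_of_nonzero k hf

theorem placeAtInfinity_isRational : (placeAtInfinity k).IsRational := by
  intro f hf
  rcases eq_or_ne f 0 with rfl | hf0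
  · exact ⟨0, by simp [Place.Vanishes]⟩
  rw [placeAtInfinity_val hf0, ← exp_zero, exp_le_exp, RatFunc.intDegree] at hf
  have hmonic : f.denom.Monic := f.monic_denom
  have hquot : (f.num /ₘ f.denom).natDegree = 0 := by
    rw [natDegree_divByMonic _ hmonic]; omega
  obtain ⟨c, hc⟩ := natDegree_eq_zero.1 hquot
  have hden : algebraMap k[X] (RatFunc k) f.denom ≠ 0 := RatFunc.algebraMap_ne_zero f.denom_ne_zero
  have hsub : f - algebraMap k (RatFunc k) c =
      algebraMap k[X] (RatFunc k) (f.num %ₘ f.denom) / algebraMap k[X] (RatFunc k) f.denom := by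
    rw [eq_div_iff hden, sub_mul, sub_eq_iff_eq_add, RatFunc.algebraMap_eq_C,
      ← RatFunc.algebraMap_C, hc, ← map_mul, ← map_add, mul_comm (_ /ₘ _), modByMonic_add_div]
    exact ((div_eq_iff hden).1 f.num_div_denom).symm
  refine ⟨c, ?_⟩
  rw [Place.Vanishes, hsub]
  rcases eq_or_ne (f.num %ₘ f.denom) 0 with h0 | h0
  · simp [h0]
  · have hnum := RatFunc.algebraMap_ne_zero h0
    rw [placeAtInfinity_val (div_ne_zero hnum hden), ← exp_zero, exp_lt_exp,
      RatFunc.intDegree_div hnum hden, RatFunc.intDegree_polynomial, RatFunc.intDegree_polynomial]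
    have := natDegree_lt_natDegree h0 (degree_modByMonic_lt f.num hmonic)
    omega

namespace Place

variable {F : Type*} [Field F] [Algebra k F] [Algebra (RatFunc k) F]
  [IsScalarTower k (RatFunc k) F] {P : Place k F}

theorem val_algebraMap_ratFunc (h : 1 < P.val (algebraMap (RatFunc k) F RatFunc.X))
    {f : RatFunc k} (hf : f ≠ 0) : P.val (algebraMap (RatFunc k) F f) =
      P.val (algebraMap (RatFunc k) F RatFunc.X) ^ f.intDegree := by
  have : (P.val.comap (algebraMap (RatFunc k) F)).IsTrivialOn k := ⟨fun c hc => by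
    rw [Valuation.comap_apply, ← IsScalarTower.algebraMap_apply]
    exact P.map_const c hc⟩
  exact RatFunc.valuation_eq_valuation_X_zpow_intDegree_of_one_lt_valuation_X
    (v := P.val.comap (algebraMap (RatFunc k) F)) h hf

theorem liesOver_placeAtInfinity_iff :
    P.LiesOver (placeAtInfinity k) ↔ 1 < P.val (algebraMap (RatFunc k) F RatFunc.X) := by
  constructor
  · intro (h : (placeAtInfinity k).val.HasExtension P.val)
    have hX := (Valuation.HasExtension.val_map_lt_iff (placeAtInfinity k).val P.val 1 RatFunc.X).2
    rw [map_one, map_one, map_one] at hX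
    refine hX ?_
    rw [placeAtInfinity_val RatFunc.X_ne_zero, RatFunc.intDegree_X, ← exp_zero, exp_lt_exp]
    exact one_pos
  · intro h
    refine ⟨Valuation.isEquiv_iff_val_le_one.2 fun {f} => ?_⟩
    rcases eq_or_ne f 0 with rfl | hf
    · simp
    · rw [Valuation.comap_apply, val_algebraMap_ratFunc h hf, placeAtInfinity_val hf,
        ← exp_zero, exp_le_exp]
      exact (zpow_le_one_iff_right₀ h).symm

theorem IsResidueGenerator.liesOverWith_placeAtInfinity {z : F} {ψ : k[X]}
    (hz : P.IsResidueGenerator z ψ) {e : ℕ} (he : 0 < e)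
    (h : P.val (algebraMap (RatFunc k) F RatFunc.X) = exp (e : ℤ)) :
    P.LiesOverWith (placeAtInfinity k) e ψ.natDegree := by
  have h1 : 1 < P.val (algebraMap (RatFunc k) F RatFunc.X) := by
    rw [h, ← exp_zero, exp_lt_exp]
    exact_mod_cast he
  have hP := liesOver_placeAtInfinity_iff.2 h1
  refine ⟨hP, fun f hf => ?_, hz.relativeDegree_eq_natDegree placeAtInfinity_isRational hP⟩
  rw [ord, ord, val_algebraMap_ratFunc h1 hf, placeAtInfinity_val hf, h, ← exp_zsmul, log_exp,
    log_exp, smul_eq_mul]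
  ring

end Place

end Infinity

/-- The point `(x, t)` lies on the plane curve which is obtained by eliminating `y` from the
equations of the affine curve with `r = 2 * n + 3`. -/
def OnCurve {R : Type*} [CommRing R] (n : ℕ) (x t : R) : Prop :=
  (x ^ (n + 2) + 1) ^ 2 = x * (x - 1) * (x - t ^ (2 * n + 4))

namespace OnCurve

variable {F Γ : Type*} [Field F] [LinearOrderedCommGroupWithZero Γ] {w : Valuation F Γ} {n : ℕ}
  {x t : F} (h : OnCurve n x t)

section Identities

include h

theorem mul_pow_sub_one_eq (ht : t ≠ 0) :
    x * t ^ (2 * n + 4) - 1 = t⁻¹ * (t⁻¹ ^ (2 * n + 3) * (x * t ^ (2 * n + 4)) *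
      (x * t ^ (2 * n + 4) + x ^ (n + 1) * (2 + x ^ (n + 2)) - x * (x - 1))) := by
  have hx : t⁻¹ * (t⁻¹ ^ (2 * n + 3) * (x * t ^ (2 * n + 4))) = x := by
    rw [← mul_assoc, ← pow_succ', mul_left_comm, inv_pow, inv_mul_cancel₀ (pow_ne_zero _ ht),
      mul_one]
  rw [← mul_assoc, hx]
  rw [OnCurve] at h
  linear_combination -h

theorem mul_sub_one_eq (ht : t ≠ 0) :
    x * (1 - x * t⁻¹ ^ (2 * n + 4)) * (x - 1) =
      t⁻¹ * (-(t⁻¹ ^ (2 * n + 3) * (x ^ (n + 2) + 1) ^ 2)) := by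
  have ht' : t⁻¹ ^ (2 * n + 4) * t ^ (2 * n + 4) = 1 := by
    rw [← mul_pow, inv_mul_cancel₀ ht, one_pow]
  rw [h, mul_neg, ← mul_assoc, ← pow_succ']
  linear_combination (-x * (x - 1)) * ht'

theorem sq_add_one_eq (hx : x ≠ 0) (ht : t ≠ 0) :
    (t⁻¹ ^ (n + 2) * x ^ (n + 1)) ^ 2 + 1 = x⁻¹ * (1 - (t⁻¹ ^ (n + 2) * x ^ (n + 1)) ^ 2 *
      (x⁻¹ ^ (n + 1) * (2 + x⁻¹ ^ (n + 2)) - (1 - x⁻¹) * x⁻¹ ^ (2 * n))) := by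
  have hT : t ^ (n + 2) ≠ 0 := pow_ne_zero _ ht
  have hA : x ^ n ≠ 0 := pow_ne_zero _ hx
  rw [OnCurve, show 2 * n + 4 = (n + 2) * 2 by ring, pow_mul] at h
  simp only [inv_pow, pow_add x, pow_mul' x] at h ⊢
  generalize t ^ (n + 2) = T at *
  generalize x ^ n = A at *
  field_simp
  linear_combination h

end Identities
end OnCurve

theorem val_eq_one_of_sub_lt_one {F Γ : Type*} [Field F] [LinearOrderedCommGroupWithZero Γ]
    {w : Valuation F Γ} {a b : F} (hb : w b = 1) (h : w (a - b) < 1) : w a = 1 := by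
  rw [← hb] at h ⊢
  exact w.map_eq_of_sub_lt h

theorem one_lt_val_of_mul_pow_eq_one {F Γ : Type*} [Field F] [LinearOrderedCommGroupWithZero Γ]
    {w : Valuation F Γ} {a t : F} {n : ℕ} (ha : w a < 1) (h : w (a * t ^ n) = 1) : 1 < w t := by
  by_contra! ht
  rw [map_mul, map_pow] at h
  exact absurd h (mul_lt_one_of_lt_of_le ha (pow_le_one' ht n)).ne

theorem val_algebraMap_eq_one {k F Γ : Type*} [Field k] [Field F] [Algebra k F]
    [LinearOrderedCommGroupWithZero Γ] {w : Valuation F Γ}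
    (hk : ∀ c : k, w (algebraMap k F c) ≤ 1) {c : k} (hc : c ≠ 0) :
    w (algebraMap k F c) = 1 := by
  have h0 : w (algebraMap k F c) ≠ 0 := w.ne_zero_iff.2 ((map_ne_zero (algebraMap k F)).2 hc)
  have hinv := hk c⁻¹
  rw [map_inv₀, map_inv₀, inv_le_one₀ (zero_lt_iff.2 h0)] at hinv
  exact (hk c).antisymm hinv

theorem val_aeval_eq_one_of_isCoprime {k F Γ : Type*} [Field k] [Field F] [Algebra k F]
    [LinearOrderedCommGroupWithZero Γ] {w : Valuation F Γ}
    (hk : ∀ c : k, w (algebraMap k F c) ≤ 1) {z : F} (hz : w z ≤ 1) {p q : k[X]}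
    (hpq : IsCoprime p q) (hp : w (aeval z p) < 1) : w (aeval z q) = 1 := by
  refine (val_aeval_le_one hk hz q).eq_of_not_lt fun hq => ?_
  obtain ⟨a, b, hab⟩ := hpq
  have h1 : w (aeval z (a * p + b * q)) < 1 := by
    rw [map_add, map_mul, map_mul]
    refine w.map_add_lt ?_ ?_ <;> rw [map_mul]
    exacts [mul_lt_one_of_nonneg_of_lt_one_right (val_aeval_le_one hk hz a) zero_le hp,
      mul_lt_one_of_nonneg_of_lt_one_right (val_aeval_le_one hk hz b) zero_le hq]
  rw [hab, map_one, map_one] at h1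
  exact h1.false

theorem inv_eq_div_pow_mul_inv_pow_mul_pow {F : Type*} [Field F] (n : ℕ) {x t : F} (hx : x ≠ 0)
    (ht : t ≠ 0) : x⁻¹ = (t / x) ^ (n + 2) * (t⁻¹ ^ (n + 2) * x ^ (n + 1)) := by
  rw [div_pow, inv_pow, pow_succ x (n + 1)]
  field_simp

namespace OnCurve

variable {F Γ : Type*} [Field F] [LinearOrderedCommGroupWithZero Γ] {w : Valuation F Γ} {n : ℕ}
  {x t : F} (h : OnCurve n x t)
include h

theorem val_mul_pow_sub_one_lt_one (hx : w x < 1) : w (x * t ^ (2 * n + 4) - 1) < 1 := by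
  have hxO : x ∈ w.integer := hx.le
  have h1 : w (1 - x) = 1 := w.map_one_sub_of_lt hx
  have hsplit : (x * t ^ (2 * n + 4) - 1) * (1 - x) =
      x * (x ^ (n + 1) * (x ^ (n + 2) + 2) + x * (1 - x) + 1) := by
    rw [OnCurve] at h
    linear_combination -h
  rw [← mul_one (w (_ - 1)), ← h1, ← map_mul, hsplit, map_mul, h1]
  refine mul_lt_one_of_lt_of_le hx ((w.mem_integer_iff _).1 ?_)
  apply_rules [add_mem, mul_mem, sub_mem, pow_mem, one_mem, ofNat_mem]

theorem one_lt_val_of_val_lt_one (hx : w x < 1) : 1 < w t :=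
  one_lt_val_of_mul_pow_eq_one hx
    (val_eq_one_of_sub_lt_one (map_one w) (h.val_mul_pow_sub_one_lt_one hx))

theorem val_sub_one_mul_pow_eq_one (h2 : w 2 = 1) (hx : w (x - 1) < 1) :
    w ((x - 1) * t ^ (2 * n + 4)) = 1 := by
  have hx1 : w x = 1 := val_eq_one_of_sub_lt_one (map_one w) hx
  have hxO : x ∈ w.integer := hx1.le
  have hsum : w (x ^ (n + 2) + 1) = 1 := by
    refine val_eq_one_of_sub_lt_one h2 ?_
    have hgeom : x ^ (n + 2) + 1 - 2 = (x - 1) * ∑ i ∈ Finset.range (n + 2), x ^ i := by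
      rw [mul_geom_sum]; ring
    rw [hgeom, map_mul]
    exact mul_lt_one_of_lt_of_le hx (sum_mem fun i _ => pow_mem hxO i)
  have hlt : w (x ^ 2 * (x - 1)) < w ((x ^ (n + 2) + 1) ^ 2) := by
    rwa [map_mul, map_pow, map_pow, hx1, hsum, one_pow, one_mul]
  have heq : x * ((x - 1) * t ^ (2 * n + 4)) = x ^ 2 * (x - 1) - (x ^ (n + 2) + 1) ^ 2 := by
    rw [OnCurve] at h
    linear_combination h
  calc w ((x - 1) * t ^ (2 * n + 4))
    _ = w (x * ((x - 1) * t ^ (2 * n + 4))) := by rw [map_mul w x, hx1, one_mul]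
    _ = w ((x ^ (n + 2) + 1) ^ 2) := by rw [heq, w.map_sub_eq_of_lt_right hlt]
    _ = 1 := by rw [map_pow, hsum, one_pow]

theorem one_lt_val_of_val_sub_one_lt_one (h2 : w 2 = 1) (hx : w (x - 1) < 1) : 1 < w t :=
  one_lt_val_of_mul_pow_eq_one hx (h.val_sub_one_mul_pow_eq_one h2 hx)

theorem val_sub_one_lt_one (ht : 1 < w t) (hx : w x = 1) : w (x - 1) < 1 := by
  have hxO : x ∈ w.integer := hx.le
  have heq : x * (x - 1) * t ^ (2 * n + 4) = x ^ 2 * (x - 1) - (x ^ (n + 2) + 1) ^ 2 := by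
    rw [OnCurve] at h
    linear_combination h
  have hle : w (x * (x - 1) * t ^ (2 * n + 4)) ≤ 1 := by
    rw [heq, ← w.mem_integer_iff]
    apply_rules [add_mem, mul_mem, sub_mem, pow_mem, one_mem]
  by_contra! h1
  rw [map_mul, map_mul, map_pow, hx, one_mul] at hle
  exact hle.not_gt ((one_lt_pow₀ ht (by omega)).trans_le (le_mul_of_one_le_left' h1))

theorem exists_mem_integer_sq_add_one_eq (ht : t ≠ 0) (hx : 1 < w x) : ∃ b ∈ w.integer,
    (t⁻¹ ^ (n + 2) * x ^ (n + 1)) ^ 2 + 1 =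
      x⁻¹ * (1 - (t⁻¹ ^ (n + 2) * x ^ (n + 1)) ^ 2 * b) := by
  have hx0 : x ≠ 0 := w.ne_zero_iff.1 (zero_le.trans_lt hx).ne'
  have hy : w x⁻¹ < 1 := by rw [map_inv₀]; exact inv_lt_one_of_one_lt₀ hx
  have hyO : x⁻¹ ∈ w.integer := hy.le
  refine ⟨_, ?_, h.sq_add_one_eq hx0 ht⟩
  apply_rules [add_mem, mul_mem, sub_mem, pow_mem, one_mem, ofNat_mem]

theorem val_inv_pow_mul_pow_eq_one (ht : t ≠ 0) (hx : 1 < w x) :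
    w (t⁻¹ ^ (n + 2) * x ^ (n + 1)) = 1 := by
  obtain ⟨b, hb, hsq⟩ := h.exists_mem_integer_sq_add_one_eq ht hx
  have hy : w x⁻¹ < 1 := by rw [map_inv₀]; exact inv_lt_one_of_one_lt₀ hx
  have h1 : w (1 + x⁻¹ * b) = 1 := by
    refine w.map_one_add_of_lt ?_
    rw [map_mul]
    exact mul_lt_one_of_lt_of_le hy hb
  have hmul : (t⁻¹ ^ (n + 2) * x ^ (n + 1)) ^ 2 * (1 + x⁻¹ * b) = x⁻¹ - 1 := by
    linear_combination hsq
  have hval := congrArg w hmul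
  rw [map_mul, h1, mul_one, w.map_sub_swap, w.map_one_sub_of_lt hy, map_pow] at hval
  exact (pow_eq_one_iff_of_nonneg zero_le two_ne_zero).1 hval

theorem val_sq_add_one_lt_one (ht : t ≠ 0) (hx : 1 < w x) :
    w ((t⁻¹ ^ (n + 2) * x ^ (n + 1)) ^ 2 + 1) < 1 := by
  obtain ⟨b, hb, hsq⟩ := h.exists_mem_integer_sq_add_one_eq ht hx
  have hz : t⁻¹ ^ (n + 2) * x ^ (n + 1) ∈ w.integer := (h.val_inv_pow_mul_pow_eq_one ht hx).le
  rw [hsq, map_mul, map_inv₀]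
  refine mul_lt_one_of_lt_of_le (inv_lt_one_of_one_lt₀ hx) ((w.mem_integer_iff _).1 ?_)
  exact sub_mem (one_mem _) (mul_mem (pow_mem hz 2) hb)

theorem val_div_lt_one (ht : t ≠ 0) (hx : 1 < w x) : w (t / x) < 1 := by
  have hx0 : x ≠ 0 := w.ne_zero_iff.1 (zero_le.trans_lt hx).ne'
  have hval := congrArg w (inv_eq_div_pow_mul_inv_pow_mul_pow n hx0 ht)
  rw [map_mul, h.val_inv_pow_mul_pow_eq_one ht hx, mul_one, map_pow, map_inv₀] at hval
  exact (pow_lt_one_iff_of_nonneg zero_le (by omega)).1 (hval ▸ inv_lt_one_of_one_lt₀ hx)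

theorem one_lt_val_of_one_lt_val (ht : t ≠ 0) (hx : 1 < w x) : 1 < w t := by
  have heq : t ^ (n + 2) * (t⁻¹ ^ (n + 2) * x ^ (n + 1)) = x ^ (n + 1) := by
    rw [← mul_assoc, ← mul_pow, mul_inv_cancel₀ ht, one_pow, one_mul]
  have hval := congrArg w heq
  rw [map_mul, h.val_inv_pow_mul_pow_eq_one ht hx, mul_one, map_pow, map_pow] at hval
  exact (one_lt_pow_iff_of_nonneg zero_le (by omega)).1 (hval ▸ one_lt_pow₀ hx n.succ_ne_zero)

end OnCurve

section Existence

variable {k F : Type*} [Field k] [Field F] [Algebra k F] {y : F}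

theorem exists_one_lt_valuation_of_transcendental (hy : Transcendental k y) :
    ∃ B : ValuationSubring F, (∀ c : k, B.valuation (algebraMap k F c) ≤ 1) ∧
      1 < B.valuation y := by
  by_contra! h
  let k' : Subalgebra k F := ⊥
  have hmem : y ∈ ⨅ V : {V : ValuationSubring F // (k'.toSubring : Set F) ⊆ V.toSubring},
      V.1.toSubring := by
    refine Subring.mem_iInf.2 fun V => (V.1.valuation_le_one_iff y).1 (h V.1 fun c => ?_)
    exact (V.1.valuation_le_one_iff _).2 (V.2 (k'.algebraMap_mem c))
  rw [iInf_valuationSubring_superset, Subring.closure_eq] at hmem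
  have : Algebra.IsIntegral k k' := inferInstance
  have hy' : IsIntegral k' y := hmem
  exact hy (isIntegral_trans (R := k) y hy').isAlgebraic

theorem exists_valuation_lt_one_of_transcendental (hy : Transcendental k y) :
    ∃ B : ValuationSubring F, (∀ c : k, B.valuation (algebraMap k F c) ≤ 1) ∧
      B.valuation y < 1 := by
  have hy' : Transcendental k y⁻¹ := fun h => hy (inv_inv y ▸ h.inv)
  obtain ⟨B, hB, h⟩ := exists_one_lt_valuation_of_transcendental hy'
  refine ⟨B, hB, ?_⟩
  rw [map_inv₀] at h
  exact (one_lt_inv_iff₀.1 h).2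

theorem adjoin_pair_eq_top_of_mem {x t u z : F} (h : IntermediateField.adjoin k {x, t} = ⊤)
    (hx : x ∈ IntermediateField.adjoin k {u, z}) (ht : t ∈ IntermediateField.adjoin k {u, z}) :
    IntermediateField.adjoin k {u, z} = ⊤ := by
  rw [eq_top_iff, ← h, IntermediateField.adjoin_le_iff]
  rintro a (rfl | rfl)
  exacts [hx, ht]

end Existence

section NewtonArc

variable {k F : Type*} [Field k] [Field F] [Algebra k F] [Algebra (RatFunc k) F]

/-- `P` is a place above `t = ∞` which belongs to the factor `ψ` of the residual polynomial of the
segment of slope `-a / e` of the Newton arc of `s` with respect to the local parameter `τ`. Its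
ramification index is the denominator `e` of the slope, so `a` is the normalized value of `s`. -/
structure Place.IsAttachedTo (P : Place k F) (τ s : F) (a : ℤ) (e : ℕ) (ψ : k[X]) : Prop where
  liesOverWith : P.LiesOverWith (placeAtInfinity k) e ψ.natDegree
  belongsTo : P.BelongsTo τ s a e ψ
  ord_eq : P.ord s = a

theorem Place.IsResidueGenerator.isAttachedTo [IsScalarTower k (RatFunc k) F] {P : Place k F}
    {x t : F} (ht : algebraMap (RatFunc k) F RatFunc.X = t) {a : ℤ} {e : ℕ} {ψ : k[X]}
    (h : P.IsResidueGenerator (t⁻¹ ^ (-a) * x ^ e) ψ) (he : 0 < e) (hPt : P.val t = exp (e : ℤ))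
    (hPx : P.val x = exp (-a)) : P.IsAttachedTo t⁻¹ x a e ψ :=
  ⟨h.liesOverWith_placeAtInfinity he (ht ▸ hPt), h.vanishes, by
    rw [Place.ord, hPx, log_exp, neg_neg]⟩

end NewtonArc

theorem separable_X_sq_add_one {k : Type*} [Field k] (h2 : (2 : k) ≠ 0) :
    (X ^ 2 + 1 : k[X]).Separable := by
  have h := separable_X_pow_sub_C (n := 2) (-1 : k) (by exact_mod_cast h2) (by simp)
  rwa [C_neg, sub_neg_eq_add, C_1] at h

namespace OnCurve

variable {k F Γ : Type*} [Field k] [Field F] [Algebra k F] [LinearOrderedCommGroupWithZero Γ]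
  {w : Valuation F Γ} {n : ℕ} {x t : F} (h : OnCurve n x t)
include h

theorem isCenteredAt_of_val_lt_one (hk : ∀ c : k, w (algebraMap k F c) ≤ 1) (hx : w x < 1) :
    IsCenteredAt w t⁻¹ (x * t ^ (2 * n + 4)) (X - 1 : k[X]) where
  const_le_one := hk
  left_lt_one := by
    rw [map_inv₀]; exact inv_lt_one_of_one_lt₀ (h.one_lt_val_of_val_lt_one hx)
  right_le_one :=
    (val_eq_one_of_sub_lt_one (map_one w) (h.val_mul_pow_sub_one_lt_one hx)).le
  aeval_lt_one := by
    rw [map_sub, aeval_X, map_one]; exact h.val_mul_pow_sub_one_lt_one hx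

theorem isCenteredAt_of_val_sub_one_lt_one (hk : ∀ c : k, w (algebraMap k F c) ≤ 1)
    (h2 : (2 : k) ≠ 0) (hx : w (x - 1) < 1) : IsCenteredAt w t⁻¹ x (X - 1 : k[X]) where
  const_le_one := hk
  left_lt_one := by
    have h2' : w 2 = 1 := map_ofNat (algebraMap k F) 2 ▸ val_algebraMap_eq_one hk h2
    rw [map_inv₀]
    exact inv_lt_one_of_one_lt₀ (h.one_lt_val_of_val_sub_one_lt_one h2' hx)
  right_le_one := (val_eq_one_of_sub_lt_one (map_one w) hx).le
  aeval_lt_one := by rwa [map_sub, aeval_X, map_one]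

theorem isCenteredAt_of_one_lt_val (hk : ∀ c : k, w (algebraMap k F c) ≤ 1) (ht : t ≠ 0)
    (hx : 1 < w x) {ψ : k[X]} (hψ : w (aeval (t⁻¹ ^ (n + 2) * x ^ (n + 1)) ψ) < 1) :
    IsCenteredAt w (t / x) (t⁻¹ ^ (n + 2) * x ^ (n + 1)) ψ where
  const_le_one := hk
  left_lt_one := h.val_div_lt_one ht hx
  right_le_one := (h.val_inv_pow_mul_pow_eq_one ht hx).le
  aeval_lt_one := hψ

section Chart

variable (hF : IntermediateField.adjoin k {x, t} = ⊤) (ht : t ≠ 0)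
  (hk : ∀ c : k, w (algebraMap k F c) ≤ 1)
include hF ht hk

theorem exists_isResidueGenerator_of_val_lt_one (hx : w x < 1) :
    ∃ P : Place k F, P.val t⁻¹ = exp (-1) ∧
      P.IsResidueGenerator (x * t ^ (2 * n + 4)) (X - 1) ∧
      ∀ P' : Place k F, P'.val x < 1 → P' = P := by
  have hid := h.mul_pow_sub_one_eq ht
  have hw := h.isCenteredAt_of_val_lt_one hk hx
  set z := x * t ^ (2 * n + 4) with hz
  have hxz : z * t⁻¹ ^ (2 * n + 4) = x := by
    rw [hz, mul_assoc, ← mul_pow, mul_inv_cancel₀ ht, one_pow, mul_one]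
  have hu : t⁻¹ ∈ Algebra.adjoin k {t⁻¹, z} := Algebra.subset_adjoin (by simp)
  have hzA : z ∈ Algebra.adjoin k {t⁻¹, z} := Algebra.subset_adjoin (by simp)
  have hxA : x ∈ Algebra.adjoin k {t⁻¹, z} := hxz ▸ mul_mem hzA (pow_mem hu _)
  have hgen : IntermediateField.adjoin k {t⁻¹, z} = ⊤ :=
    adjoin_pair_eq_top_of_mem hF (IntermediateField.algebra_adjoin_le_adjoin k _ hxA)
      (inv_mem_iff.1 (IntermediateField.algebra_adjoin_le_adjoin k _ hu))
  obtain ⟨P, hPu, hP, hunique⟩ := Place.exists_of_isCenteredAt hgen (inv_ne_zero ht)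
    (irreducible_X_sub_C (1 : k)) hw (one_mem _)
    (mul_mem (mul_mem (pow_mem hu _) hzA) (sub_mem (add_mem hzA (mul_mem (pow_mem hxA _)
      (add_mem (ofNat_mem _ 2) (pow_mem hxA _)))) (mul_mem hxA (sub_mem hxA (one_mem _)))))
    (map_one w) (by simpa using hid)
  exact ⟨P, hPu, hP, fun P' hP' =>
    hunique P' (h.isCenteredAt_of_val_lt_one P'.val_algebraMap_le_one hP')⟩

theorem exists_isResidueGenerator_of_val_sub_one_lt_one (h2 : (2 : k) ≠ 0) (hx : w (x - 1) < 1) :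
    ∃ P : Place k F, P.val t⁻¹ = exp (-1) ∧ P.IsResidueGenerator x (X - 1) ∧
      ∀ P' : Place k F, P'.val (x - 1) < 1 → P' = P := by
  have hu : t⁻¹ ∈ Algebra.adjoin k {t⁻¹, x} := Algebra.subset_adjoin (by simp)
  have hxA : x ∈ Algebra.adjoin k {t⁻¹, x} := Algebra.subset_adjoin (by simp)
  have hgen : IntermediateField.adjoin k {t⁻¹, x} = ⊤ :=
    adjoin_pair_eq_top_of_mem hF (IntermediateField.algebra_adjoin_le_adjoin k _ hxA)
      (inv_mem_iff.1 (IntermediateField.algebra_adjoin_le_adjoin k _ hu))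
  have hw := h.isCenteredAt_of_val_sub_one_lt_one hk h2 hx
  have hg : w (x * (1 - x * t⁻¹ ^ (2 * n + 4))) = 1 := by
    have hx1 : w x = 1 := val_eq_one_of_sub_lt_one (map_one w) hx
    rw [map_mul, hx1, one_mul]
    refine w.map_one_sub_of_lt ?_
    rw [map_mul, hx1, one_mul, map_pow]
    exact pow_lt_one₀ zero_le hw.left_lt_one (by omega)
  obtain ⟨P, hPu, hP, hunique⟩ := Place.exists_of_isCenteredAt hgen (inv_ne_zero ht)
    (irreducible_X_sub_C (1 : k)) hw
    (mul_mem hxA (sub_mem (one_mem _) (mul_mem hxA (pow_mem hu _))))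
    (neg_mem (mul_mem (pow_mem hu _) (pow_mem (add_mem (pow_mem hxA _) (one_mem _)) 2)))
    hg (by simpa using h.mul_sub_one_eq ht)
  exact ⟨P, hPu, hP, fun P' hP' =>
    hunique P' (h.isCenteredAt_of_val_sub_one_lt_one P'.val_algebraMap_le_one h2 hP')⟩

theorem exists_isResidueGenerator_of_one_lt_val (h2 : (2 : k) ≠ 0) (hx : 1 < w x) {ψ : k[X]}
    (hψ : Irreducible ψ) (hdvd : ψ ∣ X ^ 2 + 1)
    (hw : w (aeval (t⁻¹ ^ (n + 2) * x ^ (n + 1)) ψ) < 1) :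
    ∃ P : Place k F, P.val (t / x) = exp (-1) ∧
      P.IsResidueGenerator (t⁻¹ ^ (n + 2) * x ^ (n + 1)) ψ ∧
      ∀ P' : Place k F, 1 < P'.val x → P'.Vanishes (aeval (t⁻¹ ^ (n + 2) * x ^ (n + 1)) ψ) →
        P' = P := by
  have hx0 : x ≠ 0 := w.ne_zero_iff.1 (zero_le.trans_lt hx).ne'
  obtain ⟨φ, hφ⟩ := hdvd
  have hcenter := h.isCenteredAt_of_one_lt_val hk ht hx hw
  have hsq := h.sq_add_one_eq hx0 ht
  have hxz := inv_eq_div_pow_mul_inv_pow_mul_pow n hx0 ht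
  set u := t / x
  set z := t⁻¹ ^ (n + 2) * x ^ (n + 1)
  have hu : u ∈ Algebra.adjoin k {u, z} := Algebra.subset_adjoin (by simp)
  have hz : z ∈ Algebra.adjoin k {u, z} := Algebra.subset_adjoin (by simp)
  have hy : x⁻¹ ∈ Algebra.adjoin k {u, z} := hxz ▸ mul_mem (pow_mem hu _) hz
  have hle := IntermediateField.algebra_adjoin_le_adjoin k {u, z}
  have hgen : IntermediateField.adjoin k {u, z} = ⊤ :=
    adjoin_pair_eq_top_of_mem hF (inv_mem_iff.1 (hle hy))
      (div_mul_cancel₀ t hx0 ▸ mul_mem (hle hu) (inv_mem_iff.1 (hle hy)))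
  have hgh : aeval z φ * aeval z ψ = u * (u ^ (n + 1) * z * (1 - z ^ 2 *
      (x⁻¹ ^ (n + 1) * (2 + x⁻¹ ^ (n + 2)) - (1 - x⁻¹) * x⁻¹ ^ (2 * n)))) := by
    rw [← mul_assoc u, ← mul_assoc u, ← pow_succ', ← hxz, ← hsq, mul_comm, ← map_mul, ← hφ]
    simp
  obtain ⟨P, hPu, hP, hunique⟩ := Place.exists_of_isCenteredAt hgen (div_ne_zero ht hx0) hψ
    hcenter (Algebra.adjoin_mono (by simp) (aeval_mem_adjoin_singleton k z))
      (mul_mem (mul_mem (pow_mem hu _) hz)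
      (sub_mem (one_mem _) (mul_mem (pow_mem hz 2) (sub_mem (mul_mem (pow_mem hy _)
        (add_mem (ofNat_mem _ 2) (pow_mem hy _))) (mul_mem (sub_mem (one_mem _) hy)
          (pow_mem hy _))))))
    (val_aeval_eq_one_of_isCoprime hk hcenter.right_le_one
      (hφ ▸ separable_X_sq_add_one h2).isCoprime hw) hgh
  exact ⟨P, hPu, hP, fun P' hP' hPψ =>
    hunique P' (h.isCenteredAt_of_one_lt_val P'.val_algebraMap_le_one ht hP' hPψ)⟩

end Chart

end OnCurve

namespace OnCurve

variable {k F : Type*} [Field k] [Field F] [Algebra k F] [Algebra (RatFunc k) F]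
  [IsScalarTower k (RatFunc k) F] {n : ℕ} {x t : F} (h : OnCurve n x t)
  (hF : IntermediateField.adjoin k {x, t} = ⊤) (ht : algebraMap (RatFunc k) F RatFunc.X = t)
include h hF ht

theorem exists_place_forall_val_lt_one_iff (hx : Transcendental k x) :
    ∃ P : Place k F, P.IsAttachedTo t⁻¹ x (2 * n + 4) 1 (X - 1) ∧
      ∀ P' : Place k F, P'.val x < 1 ↔ P' = P := by
  have ht0 : t ≠ 0 := ht ▸ (_root_.map_ne_zero _).2 RatFunc.X_ne_zero
  obtain ⟨B, hk, hBx⟩ := exists_valuation_lt_one_of_transcendental hx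
  obtain ⟨P, hPu, hP, hunique⟩ := h.exists_isResidueGenerator_of_val_lt_one hF ht0 hk hBx
  have hPt : P.val t = exp 1 := by
    rw [← inv_inv t, map_inv₀, hPu, exp_neg, inv_inv]
  have hPz : P.val (x * t ^ (2 * n + 4)) = 1 := by
    refine val_eq_one_of_sub_lt_one (map_one _) ?_
    simpa [Place.Vanishes] using hP.vanishes
  have hPx : P.val x = exp (-(2 * n + 4 : ℤ)) := by
    rw [map_mul, map_pow, hPt, ← exp_nsmul, nsmul_one] at hPz
    rw [exp_neg, eq_inv_of_mul_eq_one_left hPz]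
    norm_cast
  have hz : x * t ^ (2 * n + 4) = t⁻¹ ^ (-(2 * n + 4 : ℤ)) * x ^ 1 := by
    rw [pow_one, inv_zpow, zpow_neg, inv_inv, mul_comm]
    norm_cast
  refine ⟨P, (hz ▸ hP).isAttachedTo ht one_pos hPt hPx, fun P' => ⟨hunique P', fun h => ?_⟩⟩
  rw [h, hPx, ← exp_zero, exp_lt_exp]
  omega

theorem exists_place_forall_val_eq_one_iff (hx : Transcendental k x) (h2 : (2 : k) ≠ 0) :
    ∃ P : Place k F, P.IsAttachedTo t⁻¹ x 0 1 (X - 1) ∧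
      ∀ P' : Place k F, 1 < P'.val t ∧ P'.val x = 1 ↔ P' = P := by
  have ht0 : t ≠ 0 := ht ▸ (_root_.map_ne_zero _).2 RatFunc.X_ne_zero
  have hx1 : Transcendental k (x - 1) := fun h => hx <| by
    simpa using h.add (isAlgebraic_one (R := k))
  obtain ⟨B, hk, hBx⟩ := exists_valuation_lt_one_of_transcendental hx1
  obtain ⟨P, hPu, hP, hunique⟩ :=
    h.exists_isResidueGenerator_of_val_sub_one_lt_one hF ht0 hk h2 hBx
  have hPt : P.val t = exp 1 := by
    rw [← inv_inv t, map_inv₀, hPu, exp_neg, inv_inv]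
  have hPx : P.val x = 1 :=
    val_eq_one_of_sub_lt_one (map_one _) (by simpa [Place.Vanishes] using hP.vanishes)
  have hP0 : P.IsResidueGenerator (t⁻¹ ^ (-0 : ℤ) * x ^ 1) (X - 1) := by simpa using hP
  refine ⟨P, hP0.isAttachedTo ht one_pos hPt (by rw [hPx, neg_zero, exp_zero]), fun P' =>
    ⟨fun hP' => hunique P' (h.val_sub_one_lt_one hP'.1 hP'.2), fun h => h ▸ ⟨?_, hPx⟩⟩⟩
  rw [hPt, ← exp_zero, exp_lt_exp]
  exact one_pos

theorem exists_place_forall_one_lt_val_iff {Γ : Type*} [LinearOrderedCommGroupWithZero Γ]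
    {w : Valuation F Γ} (hk : ∀ c : k, w (algebraMap k F c) ≤ 1) (h2 : (2 : k) ≠ 0)
    (hx : 1 < w x) {ψ : k[X]} (hψ : Irreducible ψ) (hdvd : ψ ∣ X ^ 2 + 1)
    (hw : w (aeval (t⁻¹ ^ (n + 2) * x ^ (n + 1)) ψ) < 1) :
    ∃ P : Place k F, P.IsAttachedTo t⁻¹ x (-(n + 2)) (n + 1) ψ ∧ ∀ P' : Place k F,
      1 < P'.val x ∧ P'.Vanishes (aeval (t⁻¹ ^ (n + 2) * x ^ (n + 1)) ψ) ↔ P' = P := by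
  have ht0 : t ≠ 0 := ht ▸ (_root_.map_ne_zero _).2 RatFunc.X_ne_zero
  have hx0 : x ≠ 0 := w.ne_zero_iff.1 (zero_le.trans_lt hx).ne'
  obtain ⟨P, hPu, hP, hunique⟩ :=
    h.exists_isResidueGenerator_of_one_lt_val hF ht0 hk h2 hx hψ hdvd hw
  have hPz : P.val (t⁻¹ ^ (n + 2) * x ^ (n + 1)) = 1 := by
    obtain ⟨φ, hφ⟩ := hdvd
    have hcoprime : IsCoprime ψ X := ⟨φ, -X, by rw [mul_comm φ, ← hφ]; ring⟩
    simpa only [aeval_X] using val_aeval_eq_one_of_isCoprime P.val_algebraMap_le_one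
      hP.val_le_one hcoprime hP.vanishes
  have hPx : P.val x = exp (n + 2 : ℤ) := by
    have hval := congrArg P.val (inv_eq_div_pow_mul_inv_pow_mul_pow n hx0 ht0)
    rw [map_mul, map_pow, hPu, hPz, mul_one, map_inv₀, exp_neg, inv_pow, inv_inj] at hval
    rw [hval, ← exp_nsmul, nsmul_one]
    norm_cast
  have hPt : P.val t = exp ((n + 1 : ℕ) : ℤ) := by
    rw [← div_mul_cancel₀ t hx0, map_mul, hPu, hPx, ← exp_add]
    congr 1
    push_cast
    ring
  have hz : t⁻¹ ^ (n + 2) = t⁻¹ ^ (-(-(n + 2 : ℤ))) := by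
    rw [neg_neg]
    norm_cast
  refine ⟨P, (hz ▸ hP).isAttachedTo ht n.succ_pos hPt (by rw [hPx, neg_neg]), fun P' =>
    ⟨fun hP' => hunique P' hP'.1 hP'.2, fun h => h ▸ ⟨?_, hP.vanishes⟩⟩⟩
  rw [hPx, ← exp_zero, exp_lt_exp]
  omega

end OnCurve

section Conjugation

theorem mul_sq_ne_mul_sq_of_prime {R : Type*} [CommRing R] [IsDomain R] [WfDvdMonoid R]
    {π f g : R} (hπ : Prime π) (hf : ¬π ∣ f) (hg : π ∣ g) (hg2 : ¬π ^ 2 ∣ g) (p : R) {q : R}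
    (hq : q ≠ 0) : f * q ^ 2 ≠ g * p ^ 2 := by
  intro h
  have hf0 : f ≠ 0 := fun h0 => hf (h0 ▸ dvd_zero π)
  have hfq : f * q ^ 2 ≠ 0 := mul_ne_zero hf0 (pow_ne_zero 2 hq)
  have hp : p ≠ 0 := by
    rintro rfl
    simp [h] at hfq
  have hfin {a : R} (ha : a ≠ 0) : FiniteMultiplicity π a := .of_not_isUnit hπ.not_isUnit ha
  have hmult := congrArg (multiplicity π) h
  rw [multiplicity_mul hπ (hfin hfq), multiplicity_mul hπ (hfin (h ▸ hfq)),
    (hfin hp).multiplicity_pow hπ, (hfin hq).multiplicity_pow hπ,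
    multiplicity_eq_zero.2 hf, multiplicity_eq_of_dvd_of_not_dvd (k := 1) (by simpa using hg) hg2]
    at hmult
  omega

theorem notMem_adjoin_of_aeval_eq_mul_sq {k F : Type*} [Field k] [Field F] [Algebra k F] {x T : F}
    (hx : Transcendental k x) {π f g : k[X]} (hπ : Prime π) (hf : ¬π ∣ f) (hg : π ∣ g)
    (hg2 : ¬π ^ 2 ∣ g) (h : aeval x f = aeval x g * T ^ 2) :
    T ∉ IntermediateField.adjoin k {x} := by
  intro hT
  obtain ⟨p, q, rfl⟩ := (IntermediateField.mem_adjoin_simple_iff k T).1 hT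
  have hinj := transcendental_iff_injective.1 hx
  have hq : q ≠ 0 := by
    rintro rfl
    rw [map_zero, div_zero, zero_pow two_ne_zero, mul_zero, ← map_zero (aeval (R := k) x)] at h
    exact hf (hinj h ▸ dvd_zero π)
  have hq' : aeval x q ≠ 0 := fun h0 => hq (hinj (h0.trans (map_zero _).symm))
  refine mul_sq_ne_mul_sq_of_prime hπ hf hg hg2 p hq (hinj ?_)
  rw [map_mul, map_mul, map_pow, map_pow, h]
  field_simp

theorem exists_algHom_apply_eq_neg_of_sq_mem_range {K F Ω : Type*} [Field K] [Field F] [Field Ω]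
    [Algebra K F] [Algebra K Ω] [Algebra F Ω] [IsScalarTower K F Ω]
    [Algebra.IsAlgebraic K F] [IsAlgClosed Ω] {z : F}
    (hz : z ∉ (algebraMap K F).range) (hz2 : z ^ 2 ∈ (algebraMap K F).range) :
    ∃ σ : F →ₐ[K] Ω, σ z = -algebraMap F Ω z := by
  obtain ⟨a, ha⟩ := hz2
  have hirr : Irreducible (X ^ 2 - C a) := by
    rw [X_pow_sub_C_irreducible_iff_of_prime Nat.prime_two]
    rintro b rfl
    rw [map_pow, sq_eq_sq_iff_eq_or_eq_neg] at ha
    rcases ha with h | h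
    · exact hz ⟨b, h⟩
    · exact hz ⟨-b, by rw [map_neg, h, neg_neg]⟩
  have hmin : minpoly K z = X ^ 2 - C a :=
    (minpoly.eq_of_irreducible_of_monic hirr (by simp [ha]) (monic_X_pow_sub_C a two_ne_zero)).symm
  have hmem : -algebraMap F Ω z ∈ (minpoly K z).rootSet Ω := by
    rw [hmin, mem_rootSet_of_ne (X_pow_sub_C_ne_zero two_pos a)]
    rw [map_sub, map_pow, aeval_X, aeval_C, neg_sq, ← map_pow, ← ha,
      ← IsScalarTower.algebraMap_apply, sub_self]
  rwa [← Algebra.IsAlgebraic.range_eval_eq_rootSet_minpoly (A := Ω) (F := K) z] at hmem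

end Conjugation

namespace OnCurve

theorem map {R S : Type*} [CommRing R] [CommRing S] {n : ℕ} {x t : R} (h : OnCurve n x t)
    (f : R →+* S) : OnCurve n (f x) (f t) := by
  rw [OnCurve] at h ⊢
  simpa only [map_mul, map_sub, map_pow, map_add, map_one] using congrArg f h

variable {k F : Type*} [Field k] [Field F] [Algebra k F] {n : ℕ} {x t : F} (h : OnCurve n x t)
include h

theorem ne_zero : x ≠ 0 := by
  rintro rfl
  simp [OnCurve] at h

theorem sub_one_ne_zero (h2 : (2 : k) ≠ 0) : x - 1 ≠ 0 := by
  have h2' : (2 : F) ≠ 0 := map_ofNat (algebraMap k F) 2 ▸ (_root_.map_ne_zero _).2 h2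
  intro h1
  obtain rfl := sub_eq_zero.1 h1
  rw [OnCurve, one_pow, one_add_one_eq_two, sub_self, mul_zero, zero_mul] at h
  exact pow_ne_zero 2 h2' h

theorem pow_mem (h2 : (2 : k) ≠ 0) {L : IntermediateField k F} (hx : x ∈ L) :
    t ^ (2 * n + 4) ∈ L := by
  have hx0 := h.ne_zero
  have hx1 := h.sub_one_ne_zero h2
  have ht : t ^ (2 * n + 4) = x - (x ^ (n + 2) + 1) ^ 2 / (x * (x - 1)) := by
    rw [OnCurve] at h
    field_simp
    linear_combination h
  rw [ht]
  exact sub_mem hx (div_mem (_root_.pow_mem (add_mem (_root_.pow_mem hx _) (one_mem _)) _)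
    (mul_mem hx (sub_mem hx (one_mem _))))

theorem transcendental (h2 : (2 : k) ≠ 0) (ht : Transcendental k t) : Transcendental k x :=
  fun hx => ht <| .of_pow (n := 2 * n + 4) (by omega) <| mem_algebraicClosure_iff.1 <|
    h.pow_mem h2 (mem_algebraicClosure_iff.2 hx)

theorem isAlgebraic_adjoin (h2 : (2 : k) ≠ 0) (hF : IntermediateField.adjoin k {x, t} = ⊤) :
    Algebra.IsAlgebraic (IntermediateField.adjoin k {x}) F := by
  let K := IntermediateField.adjoin k {x}
  have hxK : x ∈ K := IntermediateField.mem_adjoin_simple_self k x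
  have ht : IsAlgebraic K t := .of_pow (n := 2 * n + 4) (by omega)
    (isAlgebraic_algebraMap (⟨_, h.pow_mem h2 hxK⟩ : K))
  have htop : (⊤ : IntermediateField k F) ≤ (algebraicClosure K F).restrictScalars k := by
    rw [← hF, IntermediateField.adjoin_le_iff]
    rintro a (rfl | rfl)
    exacts [mem_algebraicClosure_iff.2 (isAlgebraic_algebraMap (⟨_, hxK⟩ : K)),
      mem_algebraicClosure_iff.2 ht]
  exact ⟨fun a => mem_algebraicClosure_iff.1 (htop IntermediateField.mem_top)⟩

/-- Solving the equation of the curve for `(t ^ (n + 2)) ^ 2` gives a rational function of `x`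
with a simple pole at `x = 1`, so it is not the square of one. -/
theorem pow_notMem_adjoin (h2 : (2 : k) ≠ 0) (hx : Transcendental k x) :
    t ^ (n + 2) ∉ IntermediateField.adjoin k {x} := by
  have hf : ¬(X - C 1 : k[X]) ∣ (X ^ (n + 2) + 1) ^ 2 - X ^ 2 * (X - 1) := by
    rw [dvd_iff_isRoot]
    simpa [one_add_one_eq_two] using h2
  have hg2 : ¬(X - C 1 : k[X]) ^ 2 ∣ X * (1 - X) := by
    have hneg : (X * (1 - X) : k[X]) = (X - C 1) * -X := by rw [C_1]; ring
    rw [hneg, sq, mul_dvd_mul_iff_left (X_sub_C_ne_zero (1 : k)), dvd_iff_isRoot]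
    simp
  refine notMem_adjoin_of_aeval_eq_mul_sq hx (prime_X_sub_C 1) hf (g := X * (1 - X)) ?_ hg2 ?_
  · rw [dvd_iff_isRoot]
    simp
  · simp only [map_sub, map_add, map_mul, map_pow, map_one, aeval_X]
    rw [OnCurve] at h
    linear_combination h

theorem exists_algHom_apply_eq_neg (h2 : (2 : k) ≠ 0)
    (hF : IntermediateField.adjoin k {x, t} = ⊤) (hx : Transcendental k x) (ht : t ≠ 0) :
    ∃ σ : F →ₐ[k] AlgebraicClosure F, σ x = algebraMap F _ x ∧
      σ (t⁻¹ ^ (n + 2) * x ^ (n + 1)) = -algebraMap F _ (t⁻¹ ^ (n + 2) * x ^ (n + 1)) := by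
  let K := IntermediateField.adjoin k {x}
  have hxK : x ∈ K := IntermediateField.mem_adjoin_simple_self k x
  have : Algebra.IsAlgebraic K F := h.isAlgebraic_adjoin h2 hF
  have hz : t⁻¹ ^ (n + 2) * x ^ (n + 1) ∉ K := fun hz => h.pow_notMem_adjoin h2 hx <| by
    have hx0 := h.ne_zero
    have hdiv : t ^ (n + 2) = x ^ (n + 1) / (t⁻¹ ^ (n + 2) * x ^ (n + 1)) := by
      rw [inv_pow]; field_simp
    exact hdiv ▸ div_mem (_root_.pow_mem hxK _) hz
  have hz2 : (t⁻¹ ^ (n + 2) * x ^ (n + 1)) ^ 2 ∈ K := by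
    rw [mul_pow, inv_pow, inv_pow, ← pow_mul, mul_comm _ 2]
    exact mul_mem (inv_mem (h.pow_mem h2 hxK)) (_root_.pow_mem (_root_.pow_mem hxK _) _)
  obtain ⟨σ, hσ⟩ := exists_algHom_apply_eq_neg_of_sq_mem_range (K := K) (Ω := AlgebraicClosure F)
    (z := t⁻¹ ^ (n + 2) * x ^ (n + 1)) (by rintro ⟨a, ha⟩; exact hz (ha ▸ a.2)) ⟨⟨_, hz2⟩, rfl⟩
  exact ⟨σ.restrictScalars k, σ.commutes ⟨x, hxK⟩, hσ⟩

end OnCurve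

namespace OnCurve

variable {k F : Type*} [Field k] [Field F] [Algebra k F] {n : ℕ} {x t : F}

theorem val_sub_lt_one_or_val_add_lt_one {Γ : Type*} [LinearOrderedCommGroupWithZero Γ]
    {w : Valuation F Γ} (h : OnCurve n x t) (ht : t ≠ 0) (hx : 1 < w x) {c : k} (hc : c ^ 2 = -1) :
    w (t⁻¹ ^ (n + 2) * x ^ (n + 1) - algebraMap k F c) < 1 ∨
      w (t⁻¹ ^ (n + 2) * x ^ (n + 1) + algebraMap k F c) < 1 := by
  have hprod := h.val_sq_add_one_lt_one ht hx
  set z := t⁻¹ ^ (n + 2) * x ^ (n + 1)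
  have hfac : z ^ 2 + 1 = (z - algebraMap k F c) * (z + algebraMap k F c) := by
    have hc' : algebraMap k F c ^ 2 = -1 := by rw [← map_pow, hc, map_neg, map_one]
    linear_combination hc'
  rw [hfac, map_mul] at hprod
  by_contra! hne
  exact hprod.not_ge (one_le_mul hne.1 hne.2)

variable (h : OnCurve n x t)
  (hF : IntermediateField.adjoin k {x, t} = ⊤) (hx : Transcendental k x) (h2 : (2 : k) ≠ 0)
include h hF hx h2

/-- At a pole of `x` one of `z - c` and `z + c` vanishes, where `z = t ^ (-(n + 2)) * x ^ (n + 1)`,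
and the conjugation `z ↦ -z` over `k(x)` exchanges the two. It need not be an automorphism of `F`,
hence the detour through `AlgebraicClosure F`. -/
theorem exists_valuation_aeval_X_sub_C_lt_one (ht : t ≠ 0) {c : k} (hc : c ^ 2 = -1) :
    ∃ (B : ValuationSubring (AlgebraicClosure F)) (w : Valuation F B.ValueGroup),
      (∀ a : k, w (algebraMap k F a) ≤ 1) ∧ 1 < w x ∧
      w (aeval (t⁻¹ ^ (n + 2) * x ^ (n + 1)) (X - C c)) < 1 := by
  let ι : F →ₐ[k] AlgebraicClosure F := IsScalarTower.toAlgHom k F _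
  obtain ⟨B, hk, hBx⟩ := exists_one_lt_valuation_of_transcendental
    ((transcendental_algebraMap_iff ι.injective).2 hx)
  obtain ⟨σ, hσx, hσz⟩ := h.exists_algHom_apply_eq_neg h2 hF hx ht
  let w (τ : F →ₐ[k] AlgebraicClosure F) : Valuation F B.ValueGroup :=
    B.valuation.comap (τ : F →+* AlgebraicClosure F)
  have hconst (τ : F →ₐ[k] AlgebraicClosure F) (a : k) : w τ (algebraMap k F a) ≤ 1 :=
    (congrArg B.valuation (τ.commutes a)).trans_le (hk a)
  set z := t⁻¹ ^ (n + 2) * x ^ (n + 1)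
  have hσ : w σ (z - algebraMap k F c) = w ι (z + algebraMap k F c) := by
    rw [← Valuation.map_neg]
    refine congrArg B.valuation ?_
    simp [hσz, ι, add_comm, ← IsScalarTower.algebraMap_apply]
  simp only [map_sub, aeval_X, aeval_C]
  rcases h.val_sub_lt_one_or_val_add_lt_one (w := w ι) ht hBx hc with hz | hz
  · exact ⟨B, w ι, hconst ι, hBx, hz⟩
  · exact ⟨B, w σ, hconst σ, hBx.trans_eq (congrArg B.valuation hσx).symm, hσ.trans_lt hz⟩

variable [Algebra (RatFunc k) F] [IsScalarTower k (RatFunc k) F]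
  (ht : algebraMap (RatFunc k) F RatFunc.X = t)
include ht

theorem exists_place_of_sq_eq_neg_one {c : k} (hc : c ^ 2 = -1) :
    ∃ P : Place k F, P.IsAttachedTo t⁻¹ x (-(n + 2)) (n + 1) (X - C c) ∧ ∀ P' : Place k F,
      1 < P'.val x ∧ P'.Vanishes (t⁻¹ ^ (n + 2) * x ^ (n + 1) - algebraMap k F c) ↔ P' = P := by
  have ht0 : t ≠ 0 := ht ▸ (_root_.map_ne_zero _).2 RatFunc.X_ne_zero
  obtain ⟨B, w, hk, hwx, hw⟩ := h.exists_valuation_aeval_X_sub_C_lt_one hF hx h2 ht0 hc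
  have hdvd : X - C c ∣ (X ^ 2 + 1 : k[X]) := by
    rw [dvd_iff_isRoot]
    simp [hc]
  simpa only [map_sub, aeval_X, aeval_C] using
    h.exists_place_forall_one_lt_val_iff hF ht hk h2 hwx (irreducible_X_sub_C c) hdvd hw

theorem exists_place_of_not_isSquare (hsq : ¬IsSquare (-1 : k)) :
    ∃ P : Place k F, P.IsAttachedTo t⁻¹ x (-(n + 2)) (n + 1) (X ^ 2 + 1) ∧
      ∀ P' : Place k F, 1 < P'.val x ↔ P' = P := by
  have ht0 : t ≠ 0 := ht ▸ (_root_.map_ne_zero _).2 RatFunc.X_ne_zero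
  have hirr : Irreducible (X ^ 2 + 1 : k[X]) := by
    have := (X_pow_sub_C_irreducible_iff_of_prime Nat.prime_two (a := (-1 : k))).2
      fun b hb => hsq ⟨b, by rw [← hb, sq]⟩
    rwa [C_neg, sub_neg_eq_add, C_1] at this
  obtain ⟨B, hk, hBx⟩ := exists_one_lt_valuation_of_transcendental hx
  obtain ⟨P, hP, hiff⟩ := h.exists_place_forall_one_lt_val_iff hF ht hk h2 hBx hirr dvd_rfl
    (by simpa using h.val_sq_add_one_lt_one ht0 hBx)
  refine ⟨P, hP, fun P' => (iff_of_eq ?_).trans (hiff P')⟩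
  exact (and_iff_left_of_imp fun hP' => by
    simpa [Place.Vanishes] using h.val_sq_add_one_lt_one ht0 hP').eq.symm

end OnCurve

section FunctionField

variable {k : Type*} [Field k] {n : ℕ}

theorem mk_X_one_eq : Ideal.Quotient.mk (curveIdeal k (2 * n + 3)) (MvPolynomial.X 1) =
    Ideal.Quotient.mk (curveIdeal k (2 * n + 3)) (MvPolynomial.X 0) ^ (n + 2) + 1 := by
  rw [← map_pow, ← map_one (Ideal.Quotient.mk (curveIdeal k (2 * n + 3))), ← map_add,
    Ideal.Quotient.eq]
  have hdiv : (2 * n + 3 + 1) / 2 = n + 2 := by omega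
  refine Ideal.subset_span ?_
  rw [hdiv]
  simp

theorem onCurve_mk_X : OnCurve n
    (Ideal.Quotient.mk (curveIdeal k (2 * n + 3)) (MvPolynomial.X 0))
    (Ideal.Quotient.mk (curveIdeal k (2 * n + 3)) (MvPolynomial.X 2)) := by
  have hmem : (MvPolynomial.X 1 ^ 2 - (MvPolynomial.X 0 ^ 3 -
      MvPolynomial.X 0 ^ 2 * (MvPolynomial.X 2 ^ (2 * n + 3 + 1) + 1) +
      MvPolynomial.X 0 * MvPolynomial.X 2 ^ (2 * n + 3 + 1)) : MvPolynomial (Fin 3) k) ∈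
      curveIdeal k (2 * n + 3) := Ideal.subset_span (by simp)
  have hzero := Ideal.Quotient.eq_zero_iff_mem.2 hmem
  simp only [map_sub, map_add, map_mul, map_pow, map_one] at hzero
  rw [OnCurve, ← mk_X_one_eq]
  linear_combination hzero

variable {F : Type*} [Field F] [Algebra (CoordRing k (2 * n + 3)) F]

theorem onCurve_xFun_tFun : OnCurve n (xFun k (2 * n + 3) F) (tFun k (2 * n + 3) F) :=
  onCurve_mk_X.map (algebraMap (CoordRing k (2 * n + 3)) F)

variable [Algebra k F] [IsScalarTower k (CoordRing k (2 * n + 3)) F]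

theorem algebraMap_mem_adjoin_xFun_tFun (a : CoordRing k (2 * n + 3)) : algebraMap _ F a ∈
    IntermediateField.adjoin k {xFun k (2 * n + 3) F, tFun k (2 * n + 3) F} := by
  set L := IntermediateField.adjoin k {xFun k (2 * n + 3) F, tFun k (2 * n + 3) F}
  have hx : xFun k (2 * n + 3) F ∈ L := IntermediateField.subset_adjoin _ _ (by simp)
  have ht : tFun k (2 * n + 3) F ∈ L := IntermediateField.subset_adjoin _ _ (by simp)
  obtain ⟨p, rfl⟩ := Ideal.Quotient.mk_surjective a
  induction p using MvPolynomial.induction_on with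
  | C c =>
    have hc := L.algebraMap_mem c
    rwa [IsScalarTower.algebraMap_apply k (CoordRing k (2 * n + 3)) F] at hc
  | add p q hp hq =>
    rw [map_add, map_add]
    exact add_mem hp hq
  | mul_X p i hp =>
    rw [map_mul, map_mul]
    refine mul_mem hp ?_
    fin_cases i
    · exact hx
    · change algebraMap _ F (Ideal.Quotient.mk _ (MvPolynomial.X 1)) ∈ L
      rw [mk_X_one_eq, map_add, map_pow, map_one]
      exact add_mem (pow_mem hx _) (one_mem _)
    · exact ht

theorem adjoin_xFun_tFun [IsFractionRing (CoordRing k (2 * n + 3)) F] :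
    IntermediateField.adjoin k {xFun k (2 * n + 3) F, tFun k (2 * n + 3) F} = ⊤ := by
  rw [eq_top_iff]
  rintro f -
  obtain ⟨a, b, -, rfl⟩ := IsFractionRing.div_surjective (A := CoordRing k (2 * n + 3)) f
  exact div_mem (algebraMap_mem_adjoin_xFun_tFun a) (algebraMap_mem_adjoin_xFun_tFun b)

end FunctionField

theorem Place.isDivisorOf_sum_single {k F : Type*} [Field k] [Field F] [Algebra k F] {f : F}
    {S : Finset (Place k F)} (hf : f ≠ 0) (hS : ∀ P : Place k F, P.val f ≠ 1 → P ∈ S) :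
    IsDivisorOf (∑ P ∈ S, Finsupp.single P (P.ord f)) f := by
  classical
  refine ⟨hf, fun P => ?_⟩
  simp only [Finsupp.finsetSum_apply, Finsupp.single_apply, Finset.sum_ite_eq']
  split_ifs with hP
  · rfl
  · rw [ord, not_not.1 (mt (hS P) hP), log_one, neg_zero]

theorem Place.not_vanishes_add_of_vanishes_sub {k F : Type*} [Field k] [Field F] [Algebra k F]
    {P : Place k F} (h2 : (2 : k) ≠ 0) {c : k} (hc : c ≠ 0) {z : F}
    (hz : P.Vanishes (z - algebraMap k F c)) : ¬P.Vanishes (z + algebraMap k F c) := by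
  intro hz'
  have hlt := P.val.map_sub_lt hz' hz
  have hsub : z + algebraMap k F c - (z - algebraMap k F c) = algebraMap k F (2 * c) := by
    rw [map_mul, map_ofNat]
    ring
  rw [hsub, P.map_const _ (mul_ne_zero h2 hc)] at hlt
  exact hlt.false

namespace OnCurve

variable {k F : Type*} [Field k] [Field F] [Algebra k F] [Algebra (RatFunc k) F]
  [IsScalarTower k (RatFunc k) F] {n : ℕ} {x t : F} (h : OnCurve n x t)
  (hF : IntermediateField.adjoin k {x, t} = ⊤) (ht : algebraMap (RatFunc k) F RatFunc.X = t)

include h ht in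
theorem liesOver_placeAtInfinity_iff {P : Place k F} : P.LiesOver (placeAtInfinity k) ↔
    P.val x < 1 ∨ (1 < P.val t ∧ P.val x = 1) ∨ 1 < P.val x := by
  have ht0 : t ≠ 0 := ht ▸ (_root_.map_ne_zero _).2 RatFunc.X_ne_zero
  rw [Place.liesOver_placeAtInfinity_iff, ht]
  refine ⟨fun hPt => ?_, ?_⟩
  · exact (lt_trichotomy (P.val x) 1).imp_right (Or.imp_left (And.intro hPt))
  · rintro (hPx | hP | hPx)
    exacts [h.one_lt_val_of_val_lt_one hPx, hP.1, h.one_lt_val_of_one_lt_val ht0 hPx]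

include h ht in
theorem transcendental_of_algebraMap_eq (h2 : (2 : k) ≠ 0) : Transcendental k x :=
  h.transcendental h2 <| ht ▸
    (transcendental_algebraMap_iff (algebraMap (RatFunc k) F).injective).2
      RatFunc.transcendental_X

include h hF ht in
theorem exists_poles_of_sq_eq_neg_one (h2 : (2 : k) ≠ 0) {c : k} (hc : c ^ 2 = -1) :
    ∃ P₃ P₄ : Place k F, P₃ ≠ P₄ ∧
      P₃.IsAttachedTo t⁻¹ x (-(n + 2)) (n + 1) (X - C c) ∧
      P₄.IsAttachedTo t⁻¹ x (-(n + 2)) (n + 1) (X + C c) ∧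
      ∀ P : Place k F, 1 < P.val x ↔ P = P₃ ∨ P = P₄ := by
  have ht0 : t ≠ 0 := ht ▸ (_root_.map_ne_zero _).2 RatFunc.X_ne_zero
  have hx := h.transcendental_of_algebraMap_eq ht h2
  have hc0 : c ≠ 0 := by rintro rfl; simp at hc
  have hc' : (-c) ^ 2 = -1 := by rw [neg_sq, hc]
  obtain ⟨P₃, hP₃, hiff₃⟩ := h.exists_place_of_sq_eq_neg_one hF hx h2 ht hc
  obtain ⟨P₄, hP₄, hiff₄⟩ := h.exists_place_of_sq_eq_neg_one hF hx h2 ht hc'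
  rw [C_neg, sub_neg_eq_add] at hP₄
  rw [map_neg, sub_neg_eq_add] at hiff₄
  refine ⟨P₃, P₄, ?_, hP₃, hP₄, fun P => ?_⟩
  · rintro rfl
    exact Place.not_vanishes_add_of_vanishes_sub h2 hc0 ((hiff₃ P₃).2 rfl).2 ((hiff₄ P₃).2 rfl).2
  · rw [← hiff₃, ← hiff₄, ← and_or_left]
    exact (and_iff_left_of_imp fun hP => h.val_sub_lt_one_or_val_add_lt_one ht0 hP hc).symm

include h hF ht in
theorem exists_places_of_sq_eq_neg_one (h2 : (2 : k) ≠ 0) {c : k} (hc : c ^ 2 = -1) :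
    ∃ P₁ P₂ P₃ P₄ : Place k F, [P₁, P₂, P₃, P₄].Nodup ∧
      {P : Place k F | P.LiesOver (placeAtInfinity k)} = {P₁, P₂, P₃, P₄} ∧
      P₁.IsAttachedTo t⁻¹ x (2 * n + 4) 1 (X - 1) ∧ P₂.IsAttachedTo t⁻¹ x 0 1 (X - 1) ∧
      P₃.IsAttachedTo t⁻¹ x (-(n + 2)) (n + 1) (X - C c) ∧
      P₄.IsAttachedTo t⁻¹ x (-(n + 2)) (n + 1) (X + C c) ∧
      Place.IsDivisorOf (Finsupp.single P₁ (2 * n + 4 : ℤ) - Finsupp.single P₃ (n + 2 : ℤ) -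
        Finsupp.single P₄ (n + 2 : ℤ)) x := by
  classical
  have hx := h.transcendental_of_algebraMap_eq ht h2
  obtain ⟨P₁, hP₁, hiff₁⟩ := h.exists_place_forall_val_lt_one_iff hF ht hx
  obtain ⟨P₂, hP₂, hiff₂⟩ := h.exists_place_forall_val_eq_one_iff hF ht hx h2
  obtain ⟨P₃, P₄, h₃₄, hP₃, hP₄, hpole⟩ := h.exists_poles_of_sq_eq_neg_one hF ht h2 hc
  have h₁ : P₁.val x < 1 := (hiff₁ P₁).2 rfl
  have h₂ : P₂.val x = 1 := ((hiff₂ P₂).2 rfl).2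
  have h₃ : 1 < P₃.val x := (hpole P₃).2 (Or.inl rfl)
  have h₄ : 1 < P₄.val x := (hpole P₄).2 (Or.inr rfl)
  have h₁₂ : P₁ ≠ P₂ := by rintro rfl; exact h₁.ne h₂
  have h₁₃ : P₁ ≠ P₃ := by rintro rfl; exact h₁.asymm h₃
  have h₁₄ : P₁ ≠ P₄ := by rintro rfl; exact h₁.asymm h₄
  have h₂₃ : P₂ ≠ P₃ := by rintro rfl; exact h₃.ne' h₂
  have h₂₄ : P₂ ≠ P₄ := by rintro rfl; exact h₄.ne' h₂
  refine ⟨P₁, P₂, P₃, P₄, by simp [h₁₂, h₁₃, h₁₄, h₂₃, h₂₄, h₃₄], ?_, hP₁, hP₂, hP₃, hP₄, ?_⟩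
  · ext P
    rw [Set.mem_ofPred_eq, h.liesOver_placeAtInfinity_iff ht, hiff₁, hiff₂, hpole]
    rfl
  · have hD := Place.isDivisorOf_sum_single (S := {P₁, P₃, P₄}) h.ne_zero fun P hP => by
      rw [Finset.mem_insert, Finset.mem_insert, Finset.mem_singleton, ← hiff₁, ← hpole]
      exact hP.lt_or_gt
    rwa [Finset.sum_insert (by simp [h₁₃, h₁₄]), Finset.sum_pair h₃₄, hP₁.ord_eq, hP₃.ord_eq,
      hP₄.ord_eq, Finsupp.single_neg, Finsupp.single_neg, ← add_assoc, ← sub_eq_add_neg,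
      ← sub_eq_add_neg] at hD

include h hF ht in
theorem exists_places_of_not_isSquare (h2 : (2 : k) ≠ 0) (hsq : ¬IsSquare (-1 : k)) :
    ∃ P₁ P₂ P₃ : Place k F, [P₁, P₂, P₃].Nodup ∧
      {P : Place k F | P.LiesOver (placeAtInfinity k)} = {P₁, P₂, P₃} ∧
      P₁.IsAttachedTo t⁻¹ x (2 * n + 4) 1 (X - 1) ∧ P₂.IsAttachedTo t⁻¹ x 0 1 (X - 1) ∧
      P₃.IsAttachedTo t⁻¹ x (-(n + 2)) (n + 1) (X ^ 2 + 1) ∧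
      Place.IsDivisorOf (Finsupp.single P₁ (2 * n + 4 : ℤ) - Finsupp.single P₃ (n + 2 : ℤ)) x := by
  classical
  have hx := h.transcendental_of_algebraMap_eq ht h2
  obtain ⟨P₁, hP₁, hiff₁⟩ := h.exists_place_forall_val_lt_one_iff hF ht hx
  obtain ⟨P₂, hP₂, hiff₂⟩ := h.exists_place_forall_val_eq_one_iff hF ht hx h2
  obtain ⟨P₃, hP₃, hiff₃⟩ := h.exists_place_of_not_isSquare hF hx h2 ht hsq
  have h₁ : P₁.val x < 1 := (hiff₁ P₁).2 rfl
  have h₂ : P₂.val x = 1 := ((hiff₂ P₂).2 rfl).2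
  have h₃ : 1 < P₃.val x := (hiff₃ P₃).2 rfl
  have h₁₂ : P₁ ≠ P₂ := by rintro rfl; exact h₁.ne h₂
  have h₁₃ : P₁ ≠ P₃ := by rintro rfl; exact h₁.asymm h₃
  have h₂₃ : P₂ ≠ P₃ := by rintro rfl; exact h₃.ne' h₂
  refine ⟨P₁, P₂, P₃, by simp [h₁₂, h₁₃, h₂₃], ?_, hP₁, hP₂, hP₃, ?_⟩
  · ext P
    rw [Set.mem_ofPred_eq, h.liesOver_placeAtInfinity_iff ht, hiff₁, hiff₂, hiff₃]
    rfl
  · have hD := Place.isDivisorOf_sum_single (S := {P₁, P₃}) h.ne_zero fun P hP => by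
      rw [Finset.mem_insert, Finset.mem_singleton, ← hiff₁, ← hiff₃]
      exact hP.lt_or_gt
    rwa [Finset.sum_pair h₁₃, hP₁.ord_eq, hP₃.ord_eq, Finsupp.single_neg, ← sub_eq_add_neg] at hD

end OnCurve

theorem two_ne_zero_of_odd_card {k : Type*} [Field k] [Finite k] (h : Odd (Nat.card k)) :
    (2 : k) ≠ 0 := by
  have := Fintype.ofFinite k
  refine Ring.two_ne_zero fun hchar => Nat.not_even_iff_odd.2 h ?_
  rw [Nat.card_eq_fintype_card, Nat.even_iff]
  exact FiniteField.even_card_of_char_two hchar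

end LRCurve

theorem mainTheorem7_general
    (r : ℕ) (hr : 3 ≤ r) (hodd : Odd r) {k : Type*} [Field k] (h2 : (2 : k) ≠ 0)
    {F : Type*} [Field F] [Algebra k F]
    [Algebra (LRCurve.CoordRing k r) F] [IsScalarTower k (LRCurve.CoordRing k r) F]
    [IsFractionRing (LRCurve.CoordRing k r) F]
    [Algebra (RatFunc k) F] [IsScalarTower k (RatFunc k) F]
    (ht : algebraMap (RatFunc k) F RatFunc.X = LRCurve.tFun k r F) :
    let x : F := LRCurve.xFun k r F
    let t : F := LRCurve.tFun k r F
    let Q : LRCurve.Place k (RatFunc k) := LRCurve.placeAtInfinity k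
    (∀ i : k, i ^ 2 = -1 →
      ∃ P₁ P₂ P₃ P₄ : LRCurve.Place k F,
        [P₁, P₂, P₃, P₄].Nodup ∧
        {P : LRCurve.Place k F | P.LiesOver Q} = {P₁, P₂, P₃, P₄} ∧
        P₁.LiesOverWith Q 1 1 ∧ P₂.LiesOverWith Q 1 1 ∧
        P₃.LiesOverWith Q ((r - 1) / 2) 1 ∧ P₄.LiesOverWith Q ((r - 1) / 2) 1 ∧
        P₁.BelongsTo t⁻¹ x (r + 1) 1 (Polynomial.X - 1) ∧
        P₂.BelongsTo t⁻¹ x 0 1 (Polynomial.X - 1) ∧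
        P₃.BelongsTo t⁻¹ x (-((r + 1) / 2)) ((r - 1) / 2) (Polynomial.X - Polynomial.C i) ∧
        P₄.BelongsTo t⁻¹ x (-((r + 1) / 2)) ((r - 1) / 2) (Polynomial.X + Polynomial.C i) ∧
        P₁.ord x = r + 1 ∧ P₂.ord x = 0 ∧
        P₃.ord x = -((r + 1) / 2) ∧ P₄.ord x = -((r + 1) / 2) ∧
        LRCurve.Place.IsDivisorOf
          (Finsupp.single P₁ ((r : ℤ) + 1) - Finsupp.single P₃ (((r : ℤ) + 1) / 2)
            - Finsupp.single P₄ (((r : ℤ) + 1) / 2)) x) ∧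
    (¬ IsSquare (-1 : k) →
      ∃ P₁ P₂ P₃ : LRCurve.Place k F,
        [P₁, P₂, P₃].Nodup ∧
        {P : LRCurve.Place k F | P.LiesOver Q} = {P₁, P₂, P₃} ∧
        P₁.LiesOverWith Q 1 1 ∧ P₂.LiesOverWith Q 1 1 ∧
        P₃.LiesOverWith Q ((r - 1) / 2) 2 ∧
        P₁.BelongsTo t⁻¹ x (r + 1) 1 (Polynomial.X - 1) ∧
        P₂.BelongsTo t⁻¹ x 0 1 (Polynomial.X - 1) ∧
        P₃.BelongsTo t⁻¹ x (-((r + 1) / 2)) ((r - 1) / 2) (Polynomial.X ^ 2 + 1) ∧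
        P₁.ord x = r + 1 ∧ P₂.ord x = 0 ∧ P₃.ord x = -((r + 1) / 2) ∧
        LRCurve.Place.IsDivisorOf
          (Finsupp.single P₁ ((r : ℤ) + 1) - Finsupp.single P₃ (((r : ℤ) + 1) / 2)) x) := by
  obtain ⟨n, rfl⟩ : ∃ n, r = 2 * n + 3 := by
    obtain ⟨l, rfl⟩ := hodd
    exact ⟨l - 1, by omega⟩
  intro x t Q
  have hC : LRCurve.OnCurve n x t := LRCurve.onCurve_xFun_tFun
  have hF : IntermediateField.adjoin k {x, t} = ⊤ := LRCurve.adjoin_xFun_tFun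
  have hsucc : ((2 * n + 3 : ℕ) : ℤ) + 1 = 2 * n + 4 := by push_cast; ring
  have hhalf : (2 * n + 4 : ℤ) / 2 = n + 2 := by omega
  have hpred : (2 * n + 3 - 1) / 2 = n + 1 := by omega
  have hdeg₁ : (Polynomial.X - 1 : Polynomial k).natDegree = 1 := by compute_degree!
  have hdeg₂ : (Polynomial.X ^ 2 + 1 : Polynomial k).natDegree = 2 := by compute_degree!
  simp only [hsucc, hhalf, hpred]
  refine ⟨fun i hi => ?_, fun hsq => ?_⟩
  · obtain ⟨P₁, P₂, P₃, P₄, hnodup, hover, hP₁, hP₂, hP₃, hP₄, hdiv⟩ :=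
      hC.exists_places_of_sq_eq_neg_one hF ht h2 hi
    exact ⟨P₁, P₂, P₃, P₄, hnodup, hover, hdeg₁ ▸ hP₁.liesOverWith, hdeg₁ ▸ hP₂.liesOverWith,
      Polynomial.natDegree_X_sub_C i ▸ hP₃.liesOverWith,
      Polynomial.natDegree_X_add_C i ▸ hP₄.liesOverWith, hP₁.belongsTo, hP₂.belongsTo,
      hP₃.belongsTo, hP₄.belongsTo, hP₁.ord_eq, hP₂.ord_eq, hP₃.ord_eq, hP₄.ord_eq, hdiv⟩
  · obtain ⟨P₁, P₂, P₃, hnodup, hover, hP₁, hP₂, hP₃, hdiv⟩ :=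
      hC.exists_places_of_not_isSquare hF ht h2 hsq
    exact ⟨P₁, P₂, P₃, hnodup, hover, hdeg₁ ▸ hP₁.liesOverWith, hdeg₁ ▸ hP₂.liesOverWith,
      hdeg₂ ▸ hP₃.liesOverWith, hP₁.belongsTo, hP₂.belongsTo, hP₃.belongsTo, hP₁.ord_eq,
      hP₂.ord_eq, hP₃.ord_eq, hdiv⟩

theorem mainTheorem7
    (r q m : ℕ) (hr : 3 ≤ r) (hodd : Odd r)
    (hq : IsPrimePow q) (hqr : q ≡ 1 [MOD r + 1]) (hm : 1 ≤ m)
    {k : Type*} [Field k] [Finite k] (hk : Nat.card k = q ^ m)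
    -- `F` is the function field of the curve
    {F : Type*} [Field F] [Algebra k F]
    [Algebra (LRCurve.CoordRing k r) F] [IsScalarTower k (LRCurve.CoordRing k r) F]
    [IsFractionRing (LRCurve.CoordRing k r) F]
    -- `F` is an extension of the rational function field `k(t)`
    [Algebra (RatFunc k) F] [IsScalarTower k (RatFunc k) F]
    (ht : algebraMap (RatFunc k) F RatFunc.X = LRCurve.tFun k r F) :
    let x : F := LRCurve.xFun k r F
    let t : F := LRCurve.tFun k r F
    let Q : LRCurve.Place k (RatFunc k) := LRCurve.placeAtInfinity k
    -- case 1: `-1` is a square in `k`, with square root `i`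
    (∀ i : k, i ^ 2 = -1 →
      ∃ P₁ P₂ P₃ P₄ : LRCurve.Place k F,
        [P₁, P₂, P₃, P₄].Nodup ∧
        {P : LRCurve.Place k F | P.LiesOver Q} = {P₁, P₂, P₃, P₄} ∧
        P₁.LiesOverWith Q 1 1 ∧ P₂.LiesOverWith Q 1 1 ∧
        P₃.LiesOverWith Q ((r - 1) / 2) 1 ∧ P₄.LiesOverWith Q ((r - 1) / 2) 1 ∧
        P₁.BelongsTo t⁻¹ x (r + 1) 1 (Polynomial.X - 1) ∧
        P₂.BelongsTo t⁻¹ x 0 1 (Polynomial.X - 1) ∧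
        P₃.BelongsTo t⁻¹ x (-((r + 1) / 2)) ((r - 1) / 2) (Polynomial.X - Polynomial.C i) ∧
        P₄.BelongsTo t⁻¹ x (-((r + 1) / 2)) ((r - 1) / 2) (Polynomial.X + Polynomial.C i) ∧
        P₁.ord x = r + 1 ∧ P₂.ord x = 0 ∧
        P₃.ord x = -((r + 1) / 2) ∧ P₄.ord x = -((r + 1) / 2) ∧
        LRCurve.Place.IsDivisorOf
          (Finsupp.single P₁ ((r : ℤ) + 1) - Finsupp.single P₃ (((r : ℤ) + 1) / 2)
            - Finsupp.single P₄ (((r : ℤ) + 1) / 2)) x) ∧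
    -- case 2: `-1` is not a square in `k`
    (¬ IsSquare (-1 : k) →
      ∃ P₁ P₂ P₃ : LRCurve.Place k F,
        [P₁, P₂, P₃].Nodup ∧
        {P : LRCurve.Place k F | P.LiesOver Q} = {P₁, P₂, P₃} ∧
        P₁.LiesOverWith Q 1 1 ∧ P₂.LiesOverWith Q 1 1 ∧
        P₃.LiesOverWith Q ((r - 1) / 2) 2 ∧
        P₁.BelongsTo t⁻¹ x (r + 1) 1 (Polynomial.X - 1) ∧
        P₂.BelongsTo t⁻¹ x 0 1 (Polynomial.X - 1) ∧
        P₃.BelongsTo t⁻¹ x (-((r + 1) / 2)) ((r - 1) / 2) (Polynomial.X ^ 2 + 1) ∧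
        P₁.ord x = r + 1 ∧ P₂.ord x = 0 ∧ P₃.ord x = -((r + 1) / 2) ∧
        LRCurve.Place.IsDivisorOf
          (Finsupp.single P₁ ((r : ℤ) + 1) - Finsupp.single P₃ (((r : ℤ) + 1) / 2)) x) := by
  have hodd_card : Odd (Nat.card k) :=
    hk ▸ (Nat.odd_iff.2 (hqr.of_dvd hodd.add_one.two_dvd)).pow
  exact mainTheorem7_general r hr hodd (LRCurve.two_ne_zero_of_odd_card hodd_card) ht
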